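/- Let $n\ge 1$, $\gamma\in(0,1)$, $T>0$, $\tau>0$, $s>0$, $p>0$. Write $\widehat f(\xi)=(2\pi)^{-n/2}\int_{\mathbb R^n} f(x)e^{-ix\cdot\xi}\,dx$ for the Fourier transform on $L^2(\mathbb R^n)$, $\|f\|_{H^l}=\big(\int_{\mathbb R^n}(1+|\xi|^2)^l|\widehat f(\xi)|^2\,d\xi\big)^{1/2}$ for the Sobolev norm, and $E_{\gamma,1}(z)=\sum_{k\ge0}z^k/\Gamma(\gamma k+1)$ for the Mittag-Leffler function. For $g\in L^2(\mathbb R^n)$, a solution of the final value problem $$\frac{\partial^\gamma u}{\partial t^\gamma}=\Delta u\ \text{ on }\mathbb R^n\times(0,T),\qquad u(\cdot,T)=g,\qquad\qquad(1)$$ is a function $u\in C([0,T],L^2(\mathbb R^n))\cap C((0,T],H^2(\mathbb R^n))$ with $u(\cdot,T)=g$ that is differentiable in $t\in(0,T)$ as an $L^2(\mathbb R^n)$-valued function and for which, at every $t\in(0,T)$, the Caputo derivative $\frac{\partial^\gamma u}{\partial t^\gamma}(\cdot,t)=\frac1{\Gamma(1-\gamma)}\int_0^t\frac{u'(r)}{(t-r)^\gamma}\,dr$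 exists as a Bochner integral in $L^2(\mathbb R^n)$ and equals $\Delta u(\cdot,t)$ in $L^2(\mathbb R^n)$. Let $\varphi$ be the mollifier with $\widehat\varphi(\xi)=(2\pi)^{-n/2}\exp(-\tau|\xi|^s)$. For $\alpha>0$ and $g^\delta\in L^2(\mathbb R^n)$ the regularized solution $u_\alpha^\delta$ is defined by $$\widehat{u_\alpha^\delta}(\xi,t)=(2\pi)^{n/2}\,\frac{E_{\gamma,1}(-|\xi|^2t^\gamma)}{E_{\gamma,1}(-|\xi|^2T^\gamma)}\,\widehat\varphi(\alpha\xi)\,\widehat{g^\delta}(\xi),\qquad t\in[0,T].$$ Let $\kappa>0$. Then the following hold. (i) There is a constant $C>0$, independent of $\delta$ and $E$ (it depends only on $n,\gamma,T,\tau,s,p,\kappa$), such that for all $E>0$ and $0<\delta\le\kappa E$, every solution $u$ of (1) with $u(\cdot,0)\in H^p(\mathbb R^n)$ and $\|u(\cdot,0)\|_{H^p}\le E$, and every $g^\delta\in L^2(\mathbb R^n)$ with $\|g-g^\delta\|_{L^2}\le\delta$, the choice $\alpha=\alpha(\delta)=(\delta/E)^{1/(p+2)}$ yields a well-defined $u_{\alpha(\delta)}^\delta(\cdot,t)\in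 L^2(\mathbb R^n)$ for all $t\in[0,T]$, and $$\|u(\cdot,0)-u_{\alpha(\delta)}^\delta(\cdot,0)\|_{H^l}\le C\,E^{\frac{2+l}{p+2}}\,\delta^{\frac{p-l}{p+2}}\qquad\text{for every } l\in[0,p]\text{ with }p-l\le s .$$ (ii) For $l=0$ this is the order-optimal rate: there is $c>0$, independent of $\delta$ and $E$, such that for all $E>0$, $0<\delta\le\kappa E$ and every map $R:L^2(\mathbb R^n)\to L^2(\mathbb R^n)$ there are $g,g^\delta\in L^2(\mathbb R^n)$ and a solution $u$ of (1) with $\|u(\cdot,0)\|_{H^p}\le E$, $\|g-g^\delta\|_{L^2}\le\delta$ and $$\|u(\cdot,0)-R(g^\delta)\|_{L^2}\ge c\,E^{\frac{2}{p+2}}\,\delta^{\frac{p}{p+2}} .$$ -/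

import Mathlib

open MeasureTheory Set Filter Topology
open scoped ENNReal FourierTransform SchwartzMap Laplacian Real

noncomputable section

namespace FracDiffusion

/-- `ℝⁿ` with the Euclidean norm. -/
abbrev Rn (n : ℕ) : Type := EuclideanSpace ℝ (Fin n)

/-- `L²(ℝⁿ)` with complex values. -/
abbrev L2 (n : ℕ) : Type := Lp ℂ 2 (volume : Measure (Rn n))

/-- The Mittag-Leffler function `E_{γ,1}` on the real line. -/
def mittagLeffler (γ x : ℝ) : ℝ :=
  ∑' k : ℕ, x ^ k / Real.Gamma (γ * k + 1)

/-- The angular frequency `ξ = 2πη`. Mathlib's Fourier transform `𝓕` has the kernel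
`exp (-2πi x·η)`; the unitary transform with the kernel `exp (-i x·ξ)` is
`ξ ↦ (2π)^(-n/2) 𝓕 f (ξ / 2π)`. So a Fourier multiplier `ξ ↦ m ξ` in the angular convention is
`η ↦ m (2πη)` for `𝓕`, and weighted `L²` norms on the Fourier side agree after the
substitution `ξ = 2πη`. -/
def freq {n : ℕ} (η : Rn n) : Rn n := (2 * π) • η

/-- The Sobolev norm `‖f‖_{H^l} = (∫ (1 + |ξ|²)^l |f̂(ξ)|² dξ)^{1/2}`; it is `∞` exactly when
`f ∉ H^l`. -/
def sobolevNorm {n : ℕ} (l : ℝ) (f : L2 n) : ℝ≥0∞ :=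
  eLpNorm (fun η : Rn n => (((1 + ‖freq η‖ ^ 2) ^ (l / 2) : ℝ) : ℂ) * (𝓕 f : L2 n) η) 2 volume

/-- The Caputo derivative of order `γ` of an `L²`-valued function of time (Bochner integral). -/
def caputoDeriv {n : ℕ} (γ : ℝ) (u : ℝ → L2 n) (t : ℝ) : L2 n :=
  (1 / Real.Gamma (1 - γ)) • ∫ s in (0 : ℝ)..t, (t - s) ^ (-γ) • deriv u s

/-- `u` is a weak solution of `∂^γ u / ∂t^γ = Δu` on `ℝⁿ × (0,T)` with `u(·,T) = g`:
it belongs to `C([0,T], L²) ∩ C((0,T], H²)`, the integral that defines the Caputo derivative makes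
sense for every `t ∈ (0,T)`, and the equation holds in `L²` for every such `t`
(`Δ` is the distributional Laplacian). -/
structure IsSolution {n : ℕ} (γ T : ℝ) (g : L2 n) (u : ℝ → L2 n) : Prop where
  continuousOn : ContinuousOn u (Icc 0 T)
  mem_H2 : ∀ t ∈ Ioc 0 T, sobolevNorm 2 (u t) < ∞
  continuous_H2 : ∀ t ∈ Ioc 0 T,
    Tendsto (fun r => sobolevNorm 2 (u r - u t)) (𝓝[Ioc 0 T] t) (𝓝 0)
  differentiableAt : ∀ t ∈ Ioo 0 T, DifferentiableAt ℝ u t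
  integrable : ∀ t ∈ Ioo 0 T,
    IntervalIntegrable (fun s => (t - s) ^ (-γ) • deriv u s) volume 0 t
  equation : ∀ t ∈ Ioo 0 T,
    ((caputoDeriv γ u t : L2 n) : 𝓢'(Rn n, ℂ)) = Δ ((u t : L2 n) : 𝓢'(Rn n, ℂ))
  final : u T = g

/-- The Fourier transform (angular unitary convention) of the mollifier kernel `φ`:
`φ̂(ξ) = (2π)^{-n/2} exp (-τ|ξ|^s)`. -/
def mollifierHat {n : ℕ} (τ s : ℝ) (ξ : Rn n) : ℝ :=
  (√(2 * π) ^ n)⁻¹ * Real.exp (-τ * ‖ξ‖ ^ s)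

/-- The symbol
`√(2π)ⁿ E_{γ,1}(-|ξ|² t^γ) / E_{γ,1}(-|ξ|² T^γ) φ̂(αξ)` of the map `g^δ ↦ u_α^δ(·,t)`. -/
def regSymbol {n : ℕ} (γ T τ s α t : ℝ) (ξ : Rn n) : ℝ :=
  √(2 * π) ^ n * (mittagLeffler γ (-‖ξ‖ ^ 2 * t ^ γ) / mittagLeffler γ (-‖ξ‖ ^ 2 * T ^ γ)) *
    mollifierHat τ s (α • ξ)

open Classical in
/-- The Fourier multiplier operator `f ↦ 𝓕⁻¹ (m(ξ) f̂(ξ))` on its maximal domain in `L²`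
(and `0` outside the domain). -/
def fourierMult {n : ℕ} (m : Rn n → ℝ) (f : L2 n) : L2 n :=
  if h : MemLp (fun η : Rn n => (m (freq η) : ℂ) * (𝓕 f : L2 n) η) 2 volume then
    𝓕⁻ (h.toLp _ : L2 n)
  else 0

/-- The regularized solution `u_α^δ(·,t)` for the noisy data `g^δ`. -/
def regSolution {n : ℕ} (γ T τ s α : ℝ) (gδ : L2 n) (t : ℝ) : L2 n :=
  fourierMult (regSymbol γ T τ s α t) gδ

end FracDiffusion

end

/-!
On the Fourier side the equation reads `∂^γ û(ξ,·) = -|ξ|² û(ξ,·)`. On a bounded set of frequencies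
the Laplacian is a bounded operator, for which the Caputo initial value problem is uniquely
solvable; since every frequency lies in such a set,
`û(ξ,t) = E_{γ,1}(-|ξ|² t^γ) û(ξ,0)` for every solution. A minimum principle for the Caputo
derivative yields `1 / (1 + Γ(1-γ) x) ≤ E_{γ,1}(-x) ≤ 1 / (1 + x / Γ(γ+1))` for `x ≥ 0`, so
recovering `u(·,0)` from `u(·,T)` costs exactly two derivatives.

Upper bound: applied to exact data the regularization only mollifies `u(·,0)`, an error of order
`α^(p-l) E` in `H^l`; it amplifies the noise by at most a constant times `α^(-(l+2))`. The choice of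
`α` balances `α^(p-l) E` against `α^(-(l+2)) δ`.

Lower bound: take `w` with frequencies `|ξ| ~ 1/α`, as large as `‖w‖_{H^p} ≤ E` allows up to
constants. The solutions starting from `w` and `-w` both have final data of norm at most `δ`, hence
both are compatible with the measurement `0`, and no reconstruction is close to both.
-/

noncomputable section

namespace FracDiffusion

/-! ### Growth of the Gamma function -/

theorem exists_pos_mul_rpow_le_Gamma {R b : ℝ} (hR : 0 < R) (hb : 0 < b) :
    ∃ c : ℝ, 0 < c ∧ ∀ y : ℝ, 0 ≤ y → c * R ^ y ≤ Real.Gamma (y + b) := by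
  have hpos : ∀ u ∈ Ioi R, 0 < u := fun u hu => hR.trans hu
  have hsub : Ioi R ⊆ Ioi 0 := Ioi_subset_Ioi hR.le
  have hInt : ∀ {a : ℝ}, 0 < a → IntegrableOn (fun u => Real.exp (-u) * u ^ (a - 1)) (Ioi R) :=
    fun ha => (Real.GammaIntegral_convergent ha).mono_set hsub
  refine ⟨∫ u in Ioi R, Real.exp (-u) * u ^ (b - 1), ?_, fun y hy => ?_⟩
  · refine (setIntegral_pos_iff_support_of_nonneg_ae ?_ (hInt hb)).2 ?_
    · filter_upwards [ae_restrict_mem measurableSet_Ioi] with u hu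
      have := hpos u hu
      exact (by positivity : 0 ≤ Real.exp (-u) * u ^ (b - 1))
    · refine lt_of_lt_of_le (b := volume (Ioi R)) (by simp) (measure_mono fun u hu => ⟨?_, hu⟩)
      have := hpos u hu
      exact (by positivity : 0 < Real.exp (-u) * u ^ (b - 1)).ne'
  · have hyb : 0 < y + b := by positivity
    rw [Real.Gamma_eq_integral hyb, ← integral_mul_const]
    calc ∫ u in Ioi R, Real.exp (-u) * u ^ (b - 1) * R ^ y
        ≤ ∫ u in Ioi R, Real.exp (-u) * u ^ (y + b - 1) := by
          refine setIntegral_mono_on ((hInt hb).mul_const _) (hInt hyb) measurableSet_Ioi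
            fun u hu => ?_
          have hu0 := hpos u hu
          rw [add_comm y b, add_sub_right_comm, Real.rpow_add hu0, ← mul_assoc]
          gcongr
          exact hu.le
      _ ≤ ∫ u in Ioi 0, Real.exp (-u) * u ^ (y + b - 1) := by
          refine setIntegral_mono_set (Real.GammaIntegral_convergent hyb) ?_ hsub.eventuallyLE
          filter_upwards [ae_restrict_mem measurableSet_Ioi] with u hu
          have hu0 : (0 : ℝ) < u := hu
          exact (by positivity : 0 ≤ Real.exp (-u) * u ^ (y + b - 1))

theorem summable_pow_div_Gamma {γ b : ℝ} (hγ : 0 < γ) (hb : 0 < b) (r : ℝ) :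
    Summable fun k : ℕ => r ^ k / Real.Gamma (γ * k + b) := by
  set q : ℝ := 2 * |r| + 1 with hq
  have hq0 : 0 < q := by positivity
  obtain ⟨c, hc, hcΓ⟩ := exists_pos_mul_rpow_le_Gamma (R := q ^ (1 / γ)) (by positivity) hb
  refine Summable.of_norm_bounded (g := fun k : ℕ => c⁻¹ * (1 / 2 : ℝ) ^ k)
    (summable_geometric_two.mul_left _) fun k => ?_
  have hΓ : 0 < Real.Gamma (γ * k + b) := Real.Gamma_pos_of_pos (by positivity)
  have hqk : c * q ^ k ≤ Real.Gamma (γ * k + b) := by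
    have h := hcΓ (γ * k) (by positivity)
    rwa [← Real.rpow_mul hq0.le, ← mul_assoc, one_div_mul_cancel hγ.ne', one_mul,
      Real.rpow_natCast] at h
  rw [norm_div, norm_pow, Real.norm_eq_abs, Real.norm_of_nonneg hΓ.le, div_le_iff₀ hΓ]
  calc |r| ^ k ≤ (1 / 2 * q) ^ k := by gcongr; rw [hq]; linarith
    _ = c⁻¹ * (1 / 2 : ℝ) ^ k * (c * q ^ k) := by rw [mul_pow]; field_simp
    _ ≤ c⁻¹ * (1 / 2 : ℝ) ^ k * Real.Gamma (γ * k + b) := by gcongr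

/-! ### Riemann–Liouville kernels -/

/-- The kernel `t^(b-1) / Γ(b)` of the Riemann–Liouville integral of order `b`. -/
def fracKernel (b t : ℝ) : ℝ := t ^ (b - 1) / Real.Gamma b

theorem fracKernel_nonneg {b t : ℝ} (hb : 0 ≤ b) (ht : 0 ≤ t) : 0 ≤ fracKernel b t :=
  div_nonneg (Real.rpow_nonneg ht _) (Real.Gamma_nonneg_of_nonneg hb)

theorem fracKernel_pos {b t : ℝ} (hb : 0 < b) (ht : 0 < t) : 0 < fracKernel b t :=
  div_pos (Real.rpow_pos_of_pos ht _) (Real.Gamma_pos_of_pos hb)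

@[simp]
theorem fracKernel_one_left (t : ℝ) : fracKernel 1 t = 1 := by simp [fracKernel]

theorem fracKernel_zero_right {b : ℝ} (hb : b ≠ 1) : fracKernel b 0 = 0 := by
  rw [fracKernel, Real.zero_rpow (sub_ne_zero.2 hb), zero_div]

theorem fracKernel_one_right (b : ℝ) : fracKernel b 1 = (Real.Gamma b)⁻¹ := by
  simp [fracKernel]

theorem measurable_fracKernel (b : ℝ) : Measurable (fracKernel b) := by
  unfold fracKernel
  fun_prop

theorem continuous_fracKernel {b : ℝ} (hb : 1 ≤ b) : Continuous (fracKernel b) :=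
  (Real.continuous_rpow_const (by linarith)).div_const _

theorem hasDerivAt_fracKernel_add_one {b t : ℝ} (hb : b ≠ 0) (ht : t ≠ 0) :
    HasDerivAt (fracKernel (b + 1)) (fracKernel b t) t := by
  have h := (Real.hasDerivAt_rpow_const (p := b) (Or.inl ht)).div_const (Real.Gamma (b + 1))
  rw [Real.Gamma_add_one hb, mul_div_mul_left _ _ hb, ← Real.Gamma_add_one hb] at h
  unfold fracKernel
  rwa [add_sub_cancel_right]

theorem fracKernel_le_fracKernel {b s t : ℝ} (hb : 1 ≤ b) (hs : 0 ≤ s) (hst : s ≤ t) :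
    fracKernel b s ≤ fracKernel b t :=
  div_le_div_of_nonneg_right (Real.rpow_le_rpow hs hst (by linarith))
    (Real.Gamma_nonneg_of_nonneg (by linarith))

theorem fracKernel_le_div_mul_fracKernel {b r s t : ℝ} (hb : 0 ≤ b) (hr : 0 < r) (hrs : r ≤ s)
    (hst : s ≤ t) : fracKernel b s ≤ t / r * fracKernel b t := by
  have hs : 0 < s := hr.trans_le hrs
  have ht : 0 < t := hs.trans_le hst
  unfold fracKernel
  rw [← mul_div_assoc]
  refine div_le_div_of_nonneg_right ?_ (Real.Gamma_nonneg_of_nonneg hb)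
  rw [Real.rpow_sub_one hs.ne', Real.rpow_sub_one ht.ne', div_mul_div_cancel₀' ht.ne']
  gcongr

theorem integral_sub_rpow_mul_rpow {a b t : ℝ} (ha : 0 < a) (hb : 0 < b) (ht : 0 < t) :
    ∫ s in (0 : ℝ)..t, (t - s) ^ (a - 1) * s ^ (b - 1) =
      t ^ (a + b - 1) * (Real.Gamma a * Real.Gamma b / Real.Gamma (a + b)) := by
  have h := Complex.betaIntegral_scaled b a ht
  rw [Complex.betaIntegral_eq_Gamma_mul_div _ _ (by simpa) (by simpa)] at h
  apply Complex.ofReal_injective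
  rw [← intervalIntegral.integral_ofReal, mul_comm (Real.Gamma a), add_comm a b]
  push_cast [← Complex.Gamma_ofReal, Complex.ofReal_cpow ht.le]
  rw [← h]
  refine intervalIntegral.integral_congr fun s hs => ?_
  rw [uIcc_of_le ht.le] at hs
  simp only [Complex.ofReal_cpow hs.1, Complex.ofReal_cpow (sub_nonneg.2 hs.2)]
  push_cast
  ring

theorem integral_fracKernel_mul_fracKernel {a b t : ℝ} (ha : 0 < a) (hb : 0 < b) (ht : 0 < t) :
    ∫ s in (0 : ℝ)..t, fracKernel a (t - s) * fracKernel b s = fracKernel (a + b) t := by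
  have hΓ : Real.Gamma a * Real.Gamma b ≠ 0 :=
    (mul_pos (Real.Gamma_pos_of_pos ha) (Real.Gamma_pos_of_pos hb)).ne'
  simp_rw [fracKernel, div_mul_div_comm]
  rw [intervalIntegral.integral_div, integral_sub_rpow_mul_rpow ha hb ht, mul_div_assoc,
    div_right_comm, div_self hΓ, mul_one_div]

theorem intervalIntegrable_fracKernel_mul_fracKernel {a b t : ℝ} (ha : 0 < a) (hb : 0 < b)
    (ht : 0 < t) :
    IntervalIntegrable (fun s => fracKernel a (t - s) * fracKernel b s) volume 0 t := by
  refine intervalIntegral.intervalIntegrable_of_integral_ne_zero ?_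
  rw [integral_fracKernel_mul_fracKernel ha hb ht]
  exact (fracKernel_pos (by positivity) ht).ne'

theorem intervalIntegrable_fracKernel_sub {a t : ℝ} (ha : 0 < a) (ht : 0 < t) :
    IntervalIntegrable (fun s => fracKernel a (t - s)) volume 0 t := by
  simpa using intervalIntegrable_fracKernel_mul_fracKernel ha one_pos ht

theorem integral_fracKernel_sub_mul_fracKernel_sub {a b r t : ℝ} (ha : 0 < a) (hb : 0 < b)
    (hrt : r < t) :
    ∫ s in r..t, fracKernel a (t - s) * fracKernel b (s - r) = fracKernel (a + b) (t - r) := by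
  rw [← integral_fracKernel_mul_fracKernel ha hb (sub_pos.2 hrt), ← sub_self r]
  simpa using (intervalIntegral.integral_comp_sub_right (a := r) (b := t)
    (fun s => fracKernel a (t - r - s) * fracKernel b s) r)

theorem intervalIntegrable_fracKernel_sub_mul_fracKernel_sub {a b r t : ℝ} (ha : 0 < a)
    (hb : 0 < b) (hrt : r < t) :
    IntervalIntegrable (fun s => fracKernel a (t - s) * fracKernel b (s - r)) volume r t := by
  refine intervalIntegral.intervalIntegrable_of_integral_ne_zero ?_
  rw [integral_fracKernel_sub_mul_fracKernel_sub ha hb hrt]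
  exact (fracKernel_pos (by positivity) (sub_pos.2 hrt)).ne'

section RiemannLiouville

/-! ### Riemann–Liouville integrals -/

variable {X : Type*} [NormedAddCommGroup X] [NormedSpace ℝ X]

/-- The Riemann–Liouville fractional integral `I^a f` with base point `0`. -/
def fracIntegral (a : ℝ) (f : ℝ → X) (t : ℝ) : X :=
  ∫ s in (0 : ℝ)..t, fracKernel a (t - s) • f s

theorem fracIntegral_one (f : ℝ → X) (t : ℝ) : fracIntegral 1 f t = ∫ s in (0 : ℝ)..t, f s := by
  simp [fracIntegral]

theorem fracIntegral_fracKernel {a b t : ℝ} (ha : 0 < a) (hb : 0 < b) (ht : 0 < t) :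
    fracIntegral a (fracKernel b) t = fracKernel (a + b) t :=
  integral_fracKernel_mul_fracKernel ha hb ht

theorem ae_restrict_Ioc_mem_Ioo (s t : ℝ) : ∀ᵐ x ∂volume.restrict (Ioc s t), x ∈ Ioo s t := by
  rw [← restrict_Ioo_eq_restrict_Ioc]
  exact ae_restrict_mem measurableSet_Ioo

theorem fracIntegral_congr {a t : ℝ} {f g : ℝ → X} (ht : 0 ≤ t) (h : EqOn f g (Ioo 0 t)) :
    fracIntegral a f t = fracIntegral a g t := by
  refine intervalIntegral.integral_congr_ae_restrict ?_
  rw [uIoc_of_le ht]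
  filter_upwards [ae_restrict_Ioc_mem_Ioo 0 t] with s hs using by rw [h hs]

theorem intervalIntegrable_fracKernel_smul {a t : ℝ} (ha : 0 < a) (ht : 0 < t) {f : ℝ → X}
    (hf : ContinuousOn f (Icc 0 t)) :
    IntervalIntegrable (fun s => fracKernel a (t - s) • f s) volume 0 t :=
  (intervalIntegrable_fracKernel_sub ha ht).smul_continuousOn (by rwa [uIcc_of_le ht.le])

theorem norm_fracIntegral_le {a b t K : ℝ} (ha : 0 < a) (hb : 0 < b) (ht : 0 < t) {f : ℝ → X}
    (hf : ∀ s ∈ Ioc 0 t, ‖f s‖ ≤ K * fracKernel b s) :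
    ‖fracIntegral a f t‖ ≤ K * fracKernel (a + b) t := by
  rw [← integral_fracKernel_mul_fracKernel ha hb ht, ← intervalIntegral.integral_const_mul]
  refine intervalIntegral.norm_integral_le_of_norm_le ht.le ?_
    ((intervalIntegrable_fracKernel_mul_fracKernel ha hb ht).const_mul K)
  filter_upwards with s hs
  have hk : 0 ≤ fracKernel a (t - s) := fracKernel_nonneg ha.le (sub_nonneg.2 hs.2)
  rw [norm_smul, Real.norm_of_nonneg hk]
  calc fracKernel a (t - s) * ‖f s‖ ≤ fracKernel a (t - s) * (K * fracKernel b s) := by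
        gcongr
        exact hf s hs
    _ = K * (fracKernel a (t - s) * fracKernel b s) := by ring

section Semigroup

/-- The kernel of `w ↦ I^a (I^b w) t` as a double integral over the square `(0,t]²`. -/
def iteratedFracKernel (a b t r s : ℝ) : ℝ :=
  (Ici s).indicator (fun r => fracKernel a (t - r) * fracKernel b (r - s)) r

variable {a b t : ℝ}

theorem iteratedFracKernel_nonneg (ha : 0 ≤ a) (hb : 0 ≤ b) {r s : ℝ} (hr : r ≤ t) :
    0 ≤ iteratedFracKernel a b t r s :=
  indicator_apply_nonneg fun hs => mul_nonneg (fracKernel_nonneg ha (sub_nonneg.2 hr))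
    (fracKernel_nonneg hb (sub_nonneg.2 hs))

theorem measurable_iteratedFracKernel :
    Measurable (Function.uncurry (iteratedFracKernel a b t)) := by
  have hmeas := measurable_fracKernel
  have : Measurable fun q : ℝ × ℝ => fracKernel a (t - q.1) * fracKernel b (q.1 - q.2) := by
    fun_prop
  exact this.indicator (measurableSet_le measurable_snd measurable_fst)

theorem Ioc_zero_inter_Ici {s : ℝ} (hs : 0 < s) : Ioc 0 t ∩ Ici s = Icc s t := by
  ext r
  simp only [mem_inter_iff, mem_Ioc, mem_Ici, mem_Icc]
  exact ⟨fun h => ⟨h.2, h.1.2⟩, fun h => ⟨⟨hs.trans_le h.1, h.2⟩, h.1⟩⟩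

theorem integrableOn_iteratedFracKernel (ha : 0 < a) (hb : 0 < b) {s : ℝ} (hs : s ∈ Ioo 0 t) :
    IntegrableOn (fun r => iteratedFracKernel a b t r s) (Ioc 0 t) := by
  unfold iteratedFracKernel
  rw [integrableOn_indicator_iff measurableSet_Ici, inter_comm, Ioc_zero_inter_Ici hs.1,
    integrableOn_Icc_iff_integrableOn_Ioc, ← intervalIntegrable_iff_integrableOn_Ioc_of_le hs.2.le]
  exact intervalIntegrable_fracKernel_sub_mul_fracKernel_sub ha hb hs.2

theorem setIntegral_iteratedFracKernel (ha : 0 < a) (hb : 0 < b) {s : ℝ} (hs : s ∈ Ioo 0 t) :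
    ∫ r in Ioc 0 t, iteratedFracKernel a b t r s = fracKernel (a + b) (t - s) := by
  unfold iteratedFracKernel
  rw [setIntegral_indicator measurableSet_Ici, Ioc_zero_inter_Ici hs.1,
    integral_Icc_eq_integral_Ioc, ← intervalIntegral.integral_of_le hs.2.le,
    integral_fracKernel_sub_mul_fracKernel_sub ha hb hs.2]

theorem setIntegral_iteratedFracKernel_smul (w : ℝ → X) {r : ℝ} (hr : r ∈ Ioc 0 t) :
    ∫ s in Ioc 0 t, iteratedFracKernel a b t r s • w s =
      fracKernel a (t - r) • fracIntegral b w r := by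
  have hind : (fun s => iteratedFracKernel a b t r s • w s) =
      (Iic r).indicator fun s => fracKernel a (t - r) • fracKernel b (r - s) • w s := by
    ext s
    by_cases h : s ≤ r <;> simp [iteratedFracKernel, h, mul_smul]
  rw [hind, setIntegral_indicator measurableSet_Iic, Ioc_inter_Iic, min_eq_right hr.2,
    ← intervalIntegral.integral_of_le hr.1.le, intervalIntegral.integral_smul, fracIntegral]

theorem aestronglyMeasurable_of_fracKernel_smul (ha : 0 < a) {w : ℝ → X}
    (hw : AEStronglyMeasurable (fun s => fracKernel a (t - s) • w s)
      (volume.restrict (Ioc 0 t))) :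
    AEStronglyMeasurable w (volume.restrict (Ioc 0 t)) := by
  have hinv : Measurable fun s => (fracKernel a (t - s))⁻¹ :=
    ((measurable_fracKernel a).comp (measurable_const.sub measurable_id)).inv
  refine (hinv.aestronglyMeasurable.smul hw).congr ?_
  filter_upwards [ae_restrict_Ioc_mem_Ioo 0 t] with s hs
  exact inv_smul_smul₀ (fracKernel_pos ha (sub_pos.2 hs.2)).ne' (w s)

theorem integrable_iteratedFracKernel_smul (ha : 0 < a) (hb : 0 < b) (ht : 0 < t) {w : ℝ → X}
    (hw : IntervalIntegrable (fun s => fracKernel (a + b) (t - s) • w s) volume 0 t) :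
    Integrable (Function.uncurry fun r s => iteratedFracKernel a b t r s • w s)
      ((volume.restrict (Ioc 0 t)).prod (volume.restrict (Ioc 0 t))) := by
  rw [intervalIntegrable_iff_integrableOn_Ioc_of_le ht.le] at hw
  have hwm := aestronglyMeasurable_of_fracKernel_smul (by positivity) hw.aestronglyMeasurable
  refine (integrable_prod_iff'
    (measurable_iteratedFracKernel.aestronglyMeasurable.smul hwm.comp_snd)).2 ⟨?_, ?_⟩
  · filter_upwards [ae_restrict_Ioc_mem_Ioo 0 t] with s hs
    exact (integrableOn_iteratedFracKernel ha hb hs).smul_const (w s)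
  · refine hw.norm.congr ?_
    filter_upwards [ae_restrict_Ioc_mem_Ioo 0 t] with s hs
    rw [norm_smul, Real.norm_of_nonneg (fracKernel_nonneg (by positivity) (sub_nonneg.2 hs.2.le)),
      ← setIntegral_iteratedFracKernel ha hb hs, ← integral_mul_const]
    refine setIntegral_congr_fun measurableSet_Ioc fun r hr => ?_
    change _ = ‖iteratedFracKernel a b t r s • w s‖
    rw [norm_smul, Real.norm_of_nonneg (iteratedFracKernel_nonneg ha.le hb.le hr.2)]

theorem fracIntegral_fracIntegral [CompleteSpace X] (ha : 0 < a) (hb : 0 < b) (ht : 0 < t)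
    {w : ℝ → X}
    (hw : IntervalIntegrable (fun s => fracKernel (a + b) (t - s) • w s) volume 0 t) :
    fracIntegral a (fracIntegral b w) t = fracIntegral (a + b) w t := by
  rw [fracIntegral, fracIntegral, intervalIntegral.integral_of_le ht.le,
    intervalIntegral.integral_of_le ht.le]
  calc ∫ r in Ioc 0 t, fracKernel a (t - r) • fracIntegral b w r
      = ∫ r in Ioc 0 t, ∫ s in Ioc 0 t, iteratedFracKernel a b t r s • w s :=
        (setIntegral_congr_fun measurableSet_Ioc fun r hr =>
          setIntegral_iteratedFracKernel_smul w hr).symm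
    _ = ∫ s in Ioc 0 t, ∫ r in Ioc 0 t, iteratedFracKernel a b t r s • w s :=
        integral_integral_swap (integrable_iteratedFracKernel_smul ha hb ht hw)
    _ = ∫ s in Ioc 0 t, fracKernel (a + b) (t - s) • w s := by
        refine integral_congr_ae ?_
        filter_upwards [ae_restrict_Ioc_mem_Ioo 0 t] with s hs
        rw [integral_smul_const, setIntegral_iteratedFracKernel ha hb hs]

end Semigroup

end RiemannLiouville

section Caputo

/-! ### Caputo derivatives -/

variable {X Y : Type*} [NormedAddCommGroup X] [NormedSpace ℝ X]
  [NormedAddCommGroup Y] [NormedSpace ℝ Y]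

/-- `f` is the Caputo derivative of order `γ` of `v` on `(0,T)`: `v ∈ C([0,T], X)` is differentiable
on `(0,T)`, and there `I^(1-γ) v' = f` with an absolutely convergent Bochner integral. -/
structure HasCaputoDerivOn (γ T : ℝ) (v f : ℝ → X) : Prop where
  continuousOn : ContinuousOn v (Icc 0 T)
  differentiableAt : ∀ t ∈ Ioo 0 T, DifferentiableAt ℝ v t
  intervalIntegrable : ∀ t ∈ Ioo 0 T,
    IntervalIntegrable (fun s => fracKernel (1 - γ) (t - s) • deriv v s) volume 0 t
  fracIntegral_deriv : ∀ t ∈ Ioo 0 T, fracIntegral (1 - γ) (deriv v) t = f t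

theorem intervalIntegrable_of_fracKernel_smul {a t : ℝ} (ha : 0 < a) (ha1 : a ≤ 1) (ht : 0 < t)
    {w : ℝ → X} (hw : IntervalIntegrable (fun s => fracKernel a (t - s) • w s) volume 0 t) :
    IntervalIntegrable w volume 0 t := by
  rw [intervalIntegrable_iff_integrableOn_Ioc_of_le ht.le] at hw ⊢
  have hkt := fracKernel_pos ha ht
  refine (hw.norm.const_mul (fracKernel a t)⁻¹).mono'
    (aestronglyMeasurable_of_fracKernel_smul ha hw.aestronglyMeasurable) ?_
  filter_upwards [ae_restrict_Ioc_mem_Ioo 0 t] with s hs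
  have hts : 0 < t - s := sub_pos.2 hs.2
  have hk : fracKernel a t ≤ fracKernel a (t - s) :=
    div_le_div_of_nonneg_right
      (Real.rpow_le_rpow_of_nonpos hts (by linarith [hs.1]) (by linarith))
      (Real.Gamma_nonneg_of_nonneg ha.le)
  rw [norm_smul, Real.norm_of_nonneg (fracKernel_nonneg ha.le hts.le), inv_mul_eq_div,
    le_div_iff₀ hkt, mul_comm]
  gcongr

namespace HasCaputoDerivOn

variable {γ T : ℝ} {v w f g : ℝ → X}

theorem congr_right (h : HasCaputoDerivOn γ T v f) (hfg : EqOn f g (Ioo 0 T)) :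
    HasCaputoDerivOn γ T v g where
  __ := h
  fracIntegral_deriv t ht := (h.fracIntegral_deriv t ht).trans (hfg ht)

theorem congr_left (h : HasCaputoDerivOn γ T v f) (hvw : EqOn v w (Icc 0 T)) :
    HasCaputoDerivOn γ T w f := by
  have hev : ∀ t ∈ Ioo 0 T, v =ᶠ[𝓝 t] w := fun t ht =>
    (hvw.mono Ioo_subset_Icc_self).eventuallyEq_of_mem (isOpen_Ioo.mem_nhds ht)
  have hderiv : ∀ t ∈ Ioo 0 T, EqOn (deriv v) (deriv w) (Ioo 0 t) := fun t ht s hs =>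
    (hev s ⟨hs.1, hs.2.trans ht.2⟩).deriv_eq
  refine ⟨h.continuousOn.congr hvw.symm,
    fun t ht => (hev t ht).differentiableAt_iff.1 (h.differentiableAt t ht), fun t ht => ?_,
    fun t ht => by rw [← fracIntegral_congr ht.1.le (hderiv t ht), h.fracIntegral_deriv t ht]⟩
  refine (h.intervalIntegrable t ht).congr_ae ?_
  rw [uIoc_of_le ht.1.le]
  filter_upwards [ae_restrict_Ioc_mem_Ioo 0 t] with s hs using by rw [hderiv t ht hs]

theorem sub (hv : HasCaputoDerivOn γ T v f) (hw : HasCaputoDerivOn γ T w g) :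
    HasCaputoDerivOn γ T (fun t => v t - w t) (fun t => f t - g t) := by
  have hderiv : ∀ t ∈ Ioo 0 T, EqOn (fun s => fracKernel (1 - γ) (t - s) • deriv v s -
      fracKernel (1 - γ) (t - s) • deriv w s)
      (fun s => fracKernel (1 - γ) (t - s) • deriv (fun t => v t - w t) s) (Ioo 0 t) := by
    intro t ht s hs
    have hs' : s ∈ Ioo 0 T := ⟨hs.1, hs.2.trans ht.2⟩
    simp only [deriv_fun_sub (hv.differentiableAt s hs') (hw.differentiableAt s hs'), smul_sub]
  refine ⟨hv.continuousOn.sub hw.continuousOn,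
    fun t ht => (hv.differentiableAt t ht).sub (hw.differentiableAt t ht), fun t ht => ?_,
    fun t ht => ?_⟩
  · refine ((hv.intervalIntegrable t ht).sub (hw.intervalIntegrable t ht)).congr_ae ?_
    rw [uIoc_of_le ht.1.le]
    filter_upwards [ae_restrict_Ioc_mem_Ioo 0 t] with s hs using hderiv t ht hs
  · rw [← hv.fracIntegral_deriv t ht, ← hw.fracIntegral_deriv t ht, fracIntegral, fracIntegral,
      fracIntegral, ← intervalIntegral.integral_sub (hv.intervalIntegrable t ht)
        (hw.intervalIntegrable t ht)]
    refine intervalIntegral.integral_congr_ae_restrict ?_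
    rw [uIoc_of_le ht.1.le]
    filter_upwards [ae_restrict_Ioc_mem_Ioo 0 t] with s hs using (hderiv t ht hs).symm

theorem clm_comp [CompleteSpace X] [CompleteSpace Y] (L : X →L[ℝ] Y)
    (h : HasCaputoDerivOn γ T v f) :
    HasCaputoDerivOn γ T (fun t => L (v t)) (fun t => L (f t)) := by
  have hderiv : ∀ t ∈ Ioo 0 T, EqOn (fun s => L (fracKernel (1 - γ) (t - s) • deriv v s))
      (fun s => fracKernel (1 - γ) (t - s) • deriv (fun t => L (v t)) s) (Ioo 0 t) := by
    intro t ht s hs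
    have hs' : HasDerivAt (fun t => L (v t)) (L (deriv v s)) s := L.hasFDerivAt.comp_hasDerivAt s
      (h.differentiableAt s ⟨hs.1, hs.2.trans ht.2⟩).hasDerivAt
    simp only [hs'.deriv, map_smul]
  refine ⟨L.continuous.comp_continuousOn h.continuousOn,
    fun t ht => L.differentiableAt.comp t (h.differentiableAt t ht), fun t ht => ?_,
    fun t ht => ?_⟩
  · have hint := h.intervalIntegrable t ht
    rw [intervalIntegrable_iff_integrableOn_Ioc_of_le ht.1.le] at hint ⊢
    refine (L.integrable_comp hint).congr ?_
    filter_upwards [ae_restrict_Ioc_mem_Ioo 0 t] with s hs using hderiv t ht hs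
  · rw [← h.fracIntegral_deriv t ht, fracIntegral, fracIntegral,
      ← L.intervalIntegral_comp_comm (h.intervalIntegrable t ht)]
    refine intervalIntegral.integral_congr_ae_restrict ?_
    rw [uIoc_of_le ht.1.le]
    filter_upwards [ae_restrict_Ioc_mem_Ioo 0 t] with s hs using (hderiv t ht hs).symm

theorem sub_eq_fracIntegral [CompleteSpace X] (hγ : γ ∈ Ioo (0 : ℝ) 1)
    (h : HasCaputoDerivOn γ T v f) {t : ℝ} (ht : t ∈ Ioo 0 T) :
    v t - v 0 = fracIntegral γ f t := by
  have hsub : ∀ s ∈ Ioo 0 t, s ∈ Ioo 0 T := fun s hs => ⟨hs.1, hs.2.trans ht.2⟩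
  have hγ' : 0 < 1 - γ := sub_pos.2 hγ.2
  have hderiv : IntervalIntegrable (deriv v) volume 0 t :=
    intervalIntegrable_of_fracKernel_smul hγ' (by linarith [hγ.1]) ht.1
      (h.intervalIntegrable t ht)
  calc v t - v 0 = ∫ s in (0 : ℝ)..t, deriv v s :=
        (intervalIntegral.integral_eq_sub_of_hasDerivAt_of_le ht.1.le
          (h.continuousOn.mono (Icc_subset_Icc_right ht.2.le))
          (fun s hs => (h.differentiableAt s (hsub s hs)).hasDerivAt) hderiv).symm
    _ = fracIntegral γ (fracIntegral (1 - γ) (deriv v)) t := by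
        rw [fracIntegral_fracIntegral hγ.1 hγ' ht.1 (by simpa using hderiv),
          add_sub_cancel, fracIntegral_one]
    _ = fracIntegral γ f t :=
        fracIntegral_congr ht.1.le fun s hs => h.fracIntegral_deriv s (hsub s hs)

end HasCaputoDerivOn

end Caputo

section MittagLefflerSeries

/-! ### The fractional evolution generated by a bounded operator -/

variable {X : Type*} [NormedAddCommGroup X] [NormedSpace ℝ X]

/-- `t^(b-1) E_{γ,b}(t^γ A) x` for a bounded operator `A`, written as a series of Riemann–Liouville
kernels so that fractional integration and differentiation only shift `b`. -/
def mlSeries (γ b : ℝ) (A : X →L[ℝ] X) (x : X) (t : ℝ) : X :=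
  ∑' k : ℕ, fracKernel (γ * k + b) t • (A ^ k) x

theorem norm_pow_apply_le (A : X →L[ℝ] X) (x : X) (k : ℕ) : ‖(A ^ k) x‖ ≤ ‖A‖ ^ k * ‖x‖ := by
  induction k with
  | zero => simp
  | succ k ih =>
    rw [pow_succ', mul_apply_eq_comp, pow_succ', mul_assoc]
    exact (A.le_opNorm _).trans (by gcongr)

theorem fracKernel_mul_fracKernel_le {b c s t : ℝ} (hb : 0 ≤ b) (hbc : b ≤ c) (hs : 0 < s)
    (hst : s ≤ t) : fracKernel c s * fracKernel b t ≤ fracKernel b s * fracKernel c t := by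
  have ht : 0 < t := hs.trans_le hst
  have hpow : s ^ (c - 1) * t ^ (b - 1) ≤ s ^ (b - 1) * t ^ (c - 1) := by
    rw [show c - 1 = (c - b) + (b - 1) by ring, Real.rpow_add hs, Real.rpow_add ht]
    have := Real.rpow_le_rpow hs.le hst (sub_nonneg.2 hbc)
    calc s ^ (c - b) * s ^ (b - 1) * t ^ (b - 1) ≤ t ^ (c - b) * s ^ (b - 1) * t ^ (b - 1) := by
          gcongr
      _ = s ^ (b - 1) * (t ^ (c - b) * t ^ (b - 1)) := by ring
  unfold fracKernel
  rw [div_mul_div_comm, div_mul_div_comm, mul_comm (Real.Gamma b)]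
  have hΓ : 0 ≤ Real.Gamma c * Real.Gamma b :=
    mul_nonneg (Real.Gamma_nonneg_of_nonneg (hb.trans hbc)) (Real.Gamma_nonneg_of_nonneg hb)
  gcongr

variable {γ b : ℝ}

theorem summable_fracKernel_mul_pow (hγ : 0 < γ) (hb : 0 < b) {t : ℝ} (ht : 0 < t) (r : ℝ) :
    Summable fun k : ℕ => fracKernel (γ * k + b) t * r ^ k := by
  refine ((summable_pow_div_Gamma hγ hb (t ^ γ * r)).mul_left (t ^ (b - 1))).congr fun k => ?_
  rw [fracKernel, mul_pow, ← Real.rpow_natCast (t ^ γ), ← Real.rpow_mul ht.le, add_sub_assoc,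
    Real.rpow_add ht]
  ring

theorem summable_fracKernel_mul_norm_pow (hγ : 0 < γ) (hb : 0 < b) (A : X →L[ℝ] X) (x : X) {t : ℝ}
    (ht : 0 < t) : Summable fun k : ℕ => fracKernel (γ * k + b) t * ‖(A ^ k) x‖ := by
  have hk (k : ℕ) := fracKernel_nonneg (b := γ * k + b) (by positivity) ht.le
  refine .of_nonneg_of_le (fun k => mul_nonneg (hk k) (norm_nonneg _)) (fun k => ?_)
    ((summable_fracKernel_mul_pow hγ hb ht ‖A‖).mul_right ‖x‖)
  rw [mul_assoc]
  exact mul_le_mul_of_nonneg_left (norm_pow_apply_le A x k) (hk k)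

theorem norm_fracKernel_smul_le {c K : ℝ} (hc : 0 ≤ c) {t : ℝ} (ht : 0 ≤ t) (x : X)
    (h : fracKernel c t ≤ K) : ‖fracKernel c t • x‖ ≤ K * ‖x‖ := by
  rw [norm_smul, Real.norm_of_nonneg (fracKernel_nonneg hc ht)]
  gcongr

theorem mlSeries_zero (hγ : 0 < γ) (A : X →L[ℝ] X) (x : X) : mlSeries γ 1 A x 0 = x := by
  rw [mlSeries, tsum_eq_single 0]
  · simp
  · intro k hk
    have : γ * k + 1 ≠ 1 := by simpa using ⟨hγ.ne', hk⟩
    rw [fracKernel_zero_right this, zero_smul]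

theorem exists_norm_mlSeries_le (hγ : 0 < γ) (hb : 0 < b) (A : X →L[ℝ] X) (x : X) {t : ℝ}
    (ht : 0 < t) : ∃ K : ℝ, ∀ s ∈ Ioc 0 t, ‖mlSeries γ b A x s‖ ≤ K * fracKernel b s := by
  have hkt := fracKernel_pos hb ht
  refine ⟨(∑' k : ℕ, fracKernel (γ * k + b) t * ‖(A ^ k) x‖) / fracKernel b t, fun s hs => ?_⟩
  rw [div_mul_eq_mul_div, mul_div_assoc]
  refine tsum_of_norm_bounded
    ((summable_fracKernel_mul_norm_pow hγ hb A x ht).hasSum.mul_right _) fun k => ?_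
  have hγk : 0 ≤ γ * k := by positivity
  refine (norm_fracKernel_smul_le (by positivity) hs.1.le _ ((le_div_iff₀ hkt).2
    (fracKernel_mul_fracKernel_le hb.le (le_add_of_nonneg_left hγk) hs.1 hs.2))).trans_eq ?_
  ring

variable [CompleteSpace X]

theorem continuousOn_mlSeries (hγ : 0 < γ) (hb : 1 ≤ b) (A : X →L[ℝ] X) (x : X) {T : ℝ}
    (hT : 0 < T) : ContinuousOn (mlSeries γ b A x) (Icc 0 T) := by
  have hk (k : ℕ) : 1 ≤ γ * k + b := hb.trans (le_add_of_nonneg_left (by positivity))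
  refine continuousOn_tsum
    (fun k => ((continuous_fracKernel (hk k)).smul continuous_const).continuousOn)
    (summable_fracKernel_mul_norm_pow hγ (zero_lt_one.trans_le hb) A x hT) fun k t ht => ?_
  exact norm_fracKernel_smul_le (zero_le_one.trans (hk k)) ht.1 _
    (fracKernel_le_fracKernel (hk k) ht.1 ht.2)

theorem hasSum_mlSeries (hγ : 0 < γ) (hb : 0 < b) (A : X →L[ℝ] X) (x : X) {t : ℝ} (ht : 0 < t) :
    HasSum (fun k : ℕ => fracKernel (γ * k + b) t • (A ^ k) x) (mlSeries γ b A x t) :=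
  (Summable.of_norm_bounded (summable_fracKernel_mul_norm_pow hγ hb A x ht) fun _ =>
    norm_fracKernel_smul_le (by positivity) ht.le _ le_rfl).hasSum

theorem map_mlSeries (hγ : 0 < γ) (hb : 0 < b) (A : X →L[ℝ] X) (x : X) {t : ℝ} (ht : 0 < t) :
    A (mlSeries γ b A x t) = mlSeries γ b A (A x) t := by
  refine (((hasSum_mlSeries hγ hb A x ht).mapL A).congr_fun fun k => ?_).unique
    (hasSum_mlSeries hγ hb A (A x) ht)
  rw [map_smul, ← mul_apply_eq_comp, ← mul_apply_eq_comp, ← pow_succ, ← pow_succ']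

theorem mlSeries_eq_add (hγ : 0 < γ) (hb : 0 < b) (A : X →L[ℝ] X) (x : X) {t : ℝ} (ht : 0 < t) :
    mlSeries γ b A x t = fracKernel b t • x + mlSeries γ (γ + b) A (A x) t := by
  rw [mlSeries, (hasSum_mlSeries hγ hb A x ht).summable.tsum_eq_zero_add]
  congr 1
  · simp
  · refine tsum_congr fun k => ?_
    rw [pow_succ, mul_apply_eq_comp, Nat.cast_succ, mul_add_one, add_assoc]

theorem hasDerivAt_mlSeries_add_one (hγ : 0 < γ) (hb : 0 < b) (A : X →L[ℝ] X) (x : X) {t : ℝ}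
    (ht : 0 < t) : HasDerivAt (mlSeries γ (b + 1) A x) (mlSeries γ b A x t) t := by
  have hγb (k : ℕ) : 0 < γ * k + b := by positivity
  have hpos : ∀ y ∈ Ioo (t / 2) (2 * t), 0 < y := fun y hy => (half_pos ht).trans hy.1
  have hderiv (k : ℕ) : ∀ y ∈ Ioo (t / 2) (2 * t),
      HasDerivAt (fun t => fracKernel (γ * k + (b + 1)) t • (A ^ k) x)
        (fracKernel (γ * k + b) y • (A ^ k) x) y := fun y hy => by
    rw [← add_assoc]
    exact (hasDerivAt_fracKernel_add_one (hγb k).ne' (hpos y hy).ne').smul_const _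
  have hbound (k : ℕ) : ∀ y ∈ Ioo (t / 2) (2 * t), ‖fracKernel (γ * k + b) y • (A ^ k) x‖ ≤
      2 * t / (t / 2) * (fracKernel (γ * k + b) (2 * t) * ‖(A ^ k) x‖) := fun y hy => by
    rw [← mul_assoc]
    exact norm_fracKernel_smul_le (hγb k).le (hpos y hy).le _
      (fracKernel_le_div_mul_fracKernel (hγb k).le (half_pos ht) hy.1.le hy.2.le)
  have htm : t ∈ Ioo (t / 2) (2 * t) := ⟨by linarith, by linarith⟩
  exact hasDerivAt_tsum_of_isPreconnected
    ((summable_fracKernel_mul_norm_pow hγ hb A x (by positivity)).mul_left _)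
    isOpen_Ioo isPreconnected_Ioo hderiv hbound htm
    (hasSum_mlSeries hγ (by positivity) A x ht).summable htm

theorem hasDerivAt_mlSeries_one (hγ : 0 < γ) (A : X →L[ℝ] X) (x : X) {t : ℝ} (ht : 0 < t) :
    HasDerivAt (mlSeries γ 1 A x) (mlSeries γ γ A (A x) t) t := by
  refine ((hasDerivAt_mlSeries_add_one hγ hγ A (A x) ht).const_add x).congr_of_eventuallyEq ?_
  filter_upwards [lt_mem_nhds ht] with s hs
  rw [mlSeries_eq_add hγ one_pos A x hs, fracKernel_one_left, one_smul]

theorem fracIntegral_mlSeries {a : ℝ} (ha : 0 < a) (hγ : 0 < γ) (hb : 0 < b) (A : X →L[ℝ] X)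
    (x : X) {t : ℝ} (ht : 0 < t) :
    fracIntegral a (mlSeries γ b A x) t = mlSeries γ (a + b) A x t := by
  have hγb (k : ℕ) : 0 < γ * k + b := by positivity
  have hadd (k : ℕ) : a + (γ * k + b) = γ * k + (a + b) := by ring
  have hint (k : ℕ) := intervalIntegrable_fracKernel_mul_fracKernel ha (hγb k) ht
  have hval (k : ℕ) := integral_fracKernel_mul_fracKernel ha (hγb k) ht
  simp_rw [intervalIntegrable_iff_integrableOn_Ioc_of_le ht.le] at hint
  simp_rw [intervalIntegral.integral_of_le ht.le, hadd] at hval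
  have hsum := hasSum_integral_of_summable_integral_norm
    (F := fun (k : ℕ) s => (fracKernel a (t - s) * fracKernel (γ * k + b) s) • (A ^ k) x)
    (fun k => (hint k).smul_const _) <| by
    refine (summable_fracKernel_mul_norm_pow hγ (add_pos ha hb) A x ht).congr fun k => ?_
    rw [← hval k, ← integral_mul_const]
    refine setIntegral_congr_fun measurableSet_Ioc fun s hs => ?_
    simp only [norm_smul]
    rw [Real.norm_of_nonneg (mul_nonneg (fracKernel_nonneg ha.le (sub_nonneg.2 hs.2))
      (fracKernel_nonneg (hγb k).le hs.1.le))]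
  rw [fracIntegral, intervalIntegral.integral_of_le ht.le]
  refine Eq.trans ?_ (hsum.unique ((hasSum_mlSeries hγ (add_pos ha hb) A x ht).congr_fun
    fun k => ?_))
  · refine setIntegral_congr_fun measurableSet_Ioc fun s _ => ?_
    simp only [mlSeries, mul_smul]
    exact (tsum_const_smul'' _).symm
  · rw [integral_smul_const, hval]

theorem hasCaputoDerivOn_mlSeries (hγ : γ ∈ Ioo (0 : ℝ) 1) (A : X →L[ℝ] X) (x : X) {T : ℝ}
    (hT : 0 < T) :
    HasCaputoDerivOn γ T (mlSeries γ 1 A x) (fun t => A (mlSeries γ 1 A x t)) := by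
  have hγ' : 0 < 1 - γ := sub_pos.2 hγ.2
  have hderiv : ∀ t, EqOn (deriv (mlSeries γ 1 A x)) (mlSeries γ γ A (A x)) (Ioo 0 t) :=
    fun _ s hs => (hasDerivAt_mlSeries_one hγ.1 A x hs.1).deriv
  refine ⟨continuousOn_mlSeries hγ.1 le_rfl A x hT,
    fun t ht => (hasDerivAt_mlSeries_one hγ.1 A x ht.1).differentiableAt, fun t ht => ?_,
    fun t ht => ?_⟩
  · obtain ⟨K, hK⟩ := exists_norm_mlSeries_le hγ.1 hγ.1 A (A x) ht.1
    refine ((intervalIntegrable_fracKernel_mul_fracKernel hγ' hγ.1 ht.1).const_mul K).mono_fun'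
      (((measurable_fracKernel _).comp
        (measurable_const.sub measurable_id)).aestronglyMeasurable.smul
          (aestronglyMeasurable_deriv _ _)) ?_
    rw [uIoc_of_le ht.1.le]
    filter_upwards [ae_restrict_Ioc_mem_Ioo 0 t] with s hs
    have hk : 0 ≤ fracKernel (1 - γ) (t - s) := fracKernel_nonneg hγ'.le (sub_nonneg.2 hs.2.le)
    rw [hderiv t hs, norm_smul, Real.norm_of_nonneg hk, mul_left_comm]
    exact mul_le_mul_of_nonneg_left (hK s ⟨hs.1, hs.2.le⟩) hk
  · rw [fracIntegral_congr ht.1.le (hderiv t), fracIntegral_mlSeries hγ' hγ.1 hγ.1 A (A x) ht.1,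
      sub_add_cancel, map_mlSeries hγ.1 one_pos A x ht.1]

theorem HasCaputoDerivOn.eqOn_mlSeries {T : ℝ} (hγ : γ ∈ Ioo (0 : ℝ) 1) (hT : 0 < T)
    {A : X →L[ℝ] X} {v : ℝ → X} (hv : HasCaputoDerivOn γ T v fun t => A (v t)) :
    EqOn v (mlSeries γ 1 A (v 0)) (Icc 0 T) := by
  have hd := hv.sub (hasCaputoDerivOn_mlSeries hγ A (v 0) hT)
  set d : ℝ → X := fun t => v t - mlSeries γ 1 A (v 0) t
  obtain ⟨M, hM⟩ := isCompact_Icc.exists_bound_of_continuousOn hd.continuousOn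
  have hvolterra : ∀ t ∈ Ioo 0 T, d t = fracIntegral γ (fun s => A (d s)) t := fun t ht => by
    have h := hd.sub_eq_fracIntegral hγ ht
    simpa [d, mlSeries_zero hγ.1] using h
  have hbound : ∀ k : ℕ, ∀ t ∈ Ioo 0 T, ‖d t‖ ≤ M * ‖A‖ ^ k * fracKernel (γ * k + 1) t := by
    intro k
    induction k with
    | zero => exact fun t ht => by simpa using hM t (Ioo_subset_Icc_self ht)
    | succ k ih =>
      intro t ht
      rw [hvolterra t ht, Nat.cast_succ, mul_add_one, add_comm (γ * k) γ, add_assoc]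
      refine norm_fracIntegral_le hγ.1 (by have := hγ.1; positivity) ht.1 fun s hs => ?_
      calc ‖A (d s)‖ ≤ ‖A‖ * (M * ‖A‖ ^ k * fracKernel (γ * k + 1) s) :=
            A.le_opNorm_of_le (ih s ⟨hs.1, hs.2.trans_lt ht.2⟩)
        _ = M * ‖A‖ ^ (k + 1) * fracKernel (γ * k + 1) s := by ring
  have heq : EqOn v (mlSeries γ 1 A (v 0)) (Ioo 0 T) := fun t ht => by
    have hlim := ((summable_fracKernel_mul_pow hγ.1 one_pos ht.1 ‖A‖).mul_left
      M).tendsto_atTop_zero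
    refine sub_eq_zero.1 (norm_le_zero_iff.1 (ge_of_tendsto' hlim fun k => ?_))
    exact (hbound k t ht).trans_eq (by ring)
  exact heq.of_subset_closure hv.continuousOn (continuousOn_mlSeries hγ.1 le_rfl A (v 0) hT)
    Ioo_subset_Icc_self (closure_Ioo hT.ne).ge

end MittagLefflerSeries

section MinimumPrinciple

/-! ### The minimum principle -/

theorem fracKernel_mul_self {a t : ℝ} (ha : a ≠ 0) (ht : 0 ≤ t) :
    fracKernel a t * t = a * fracKernel (a + 1) t := by
  rw [fracKernel, fracKernel, Real.Gamma_add_one ha, add_sub_cancel_right]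
  rcases ht.eq_or_lt with rfl | ht
  · simp [Real.zero_rpow ha]
  · rw [Real.rpow_sub_one ht.ne']
    field_simp

theorem hasDerivAt_fracKernel {a t : ℝ} (ht : t ≠ 0) :
    HasDerivAt (fracKernel a) ((a - 1) * t ^ (a - 2) / Real.Gamma a) t := by
  have h := (Real.hasDerivAt_rpow_const (p := a - 1) (Or.inl ht)).div_const (Real.Gamma a)
  rwa [sub_sub, one_add_one_eq_two] at h

theorem tendsto_fracKernel_sub_mul_sub {a t : ℝ} (ha : 0 < a) {d : ℝ → ℝ}
    (hd : DifferentiableAt ℝ d t) :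
    Tendsto (fun s => fracKernel a (t - s) * (d s - d t)) (𝓝[≤] t) (𝓝 0) := by
  obtain ⟨C, hC⟩ := hd.isBigO_sub.bound
  have hlim : Tendsto (fun s => C * (a * fracKernel (a + 1) (t - s))) (𝓝[≤] t) (𝓝 0) := by
    have hcont : Continuous fun s => C * (a * fracKernel (a + 1) (t - s)) := continuous_const.mul
      (continuous_const.mul ((continuous_fracKernel (by linarith)).comp
        (continuous_const.sub continuous_id)))
    have h := (hcont.tendsto t).mono_left (nhdsWithin_le_nhds (s := Iic t))
    rwa [sub_self, fracKernel_zero_right (by linarith), mul_zero, mul_zero] at h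
  refine squeeze_zero_norm' ?_ hlim
  filter_upwards [nhdsWithin_le_nhds hC, self_mem_nhdsWithin] with s hs hst
  have hts : 0 ≤ t - s := sub_nonneg.2 hst
  rw [norm_sub_rev s t, Real.norm_of_nonneg hts] at hs
  rw [norm_mul, Real.norm_of_nonneg (fracKernel_nonneg ha.le hts), ← fracKernel_mul_self ha.ne' hts,
    mul_left_comm]
  exact mul_le_mul_of_nonneg_left hs (fracKernel_nonneg ha.le hts)

theorem continuousOn_fracKernel_sub_mul_sub {a t : ℝ} (ha : 0 < a) {d : ℝ → ℝ}
    (hcont : ContinuousOn d (Icc 0 t)) (hd : DifferentiableAt ℝ d t) :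
    ContinuousOn (fun s => fracKernel a (t - s) * (d s - d t)) (Icc 0 t) := by
  intro s hs
  rcases hs.2.lt_or_eq with hst | rfl
  · have hk : ContinuousAt (fun s => fracKernel a (t - s)) s :=
      ((hasDerivAt_fracKernel (sub_pos.2 hst).ne').continuousAt).comp' (by fun_prop)
    exact hk.continuousWithinAt.mul ((hcont s hs).sub continuousWithinAt_const)
  · have h := (tendsto_fracKernel_sub_mul_sub ha hd).mono_left
      (nhdsWithin_mono s (Icc_subset_Iic_self (a := 0)))
    simpa [ContinuousWithinAt] using h

/-- Luchko's extremum principle: integrate `K d' ≤ (K (d - d t))'`, `K s = fracKernel a (t - s)`. -/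
theorem fracIntegral_deriv_le_of_forall_le {a t : ℝ} (ha : a ∈ Ioc (0 : ℝ) 1) (ht : 0 < t)
    {d : ℝ → ℝ} (hcont : ContinuousOn d (Icc 0 t)) (hd : ∀ s ∈ Ioc 0 t, DifferentiableAt ℝ d s)
    (hint : IntervalIntegrable (fun s => fracKernel a (t - s) • deriv d s) volume 0 t)
    (hmin : ∀ s ∈ Icc 0 t, d t ≤ d s) :
    fracIntegral a (deriv d) t ≤ fracKernel a t * (d t - d 0) := by
  have hderiv : ∀ s ∈ Ioo 0 t, HasDerivAt (fun s => fracKernel a (t - s) * (d s - d t))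
      (-((a - 1) * (t - s) ^ (a - 2) / Real.Gamma a) * (d s - d t) +
        fracKernel a (t - s) * deriv d s) s := fun s hs =>
    ((hasDerivAt_fracKernel (sub_pos.2 hs.2).ne').comp_const_sub t s).mul
      ((hd s ⟨hs.1, hs.2.le⟩).hasDerivAt.sub_const _)
  have hle : ∀ s ∈ Ioo 0 t, fracKernel a (t - s) • deriv d s ≤
      -((a - 1) * (t - s) ^ (a - 2) / Real.Gamma a) * (d s - d t) +
        fracKernel a (t - s) * deriv d s := fun s hs => by
    rw [smul_eq_mul, ← neg_div, ← neg_mul, neg_sub]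
    refine le_add_of_nonneg_left (mul_nonneg (div_nonneg (mul_nonneg (sub_nonneg.2 ha.2)
      (Real.rpow_nonneg (sub_nonneg.2 hs.2.le) _)) (Real.Gamma_nonneg_of_nonneg ha.1.le)) ?_)
    exact sub_nonneg.2 (hmin s (Ioo_subset_Icc_self hs))
  rw [intervalIntegrable_iff_integrableOn_Ioc_of_le ht.le,
    ← integrableOn_Icc_iff_integrableOn_Ioc] at hint
  refine (intervalIntegral.integral_le_sub_of_hasDeriv_right_of_le ht.le
    (continuousOn_fracKernel_sub_mul_sub ha.1 hcont (hd t ⟨ht, le_rfl⟩))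
    (fun s hs => (hderiv s hs).hasDerivWithinAt) hint hle).trans_eq ?_
  rw [sub_self, sub_self, mul_zero, sub_zero]
  ring

theorem HasCaputoDerivOn.nonneg {γ T : ℝ} (hγ : γ ∈ Ioo (0 : ℝ) 1) {d f : ℝ → ℝ}
    (h : HasCaputoDerivOn γ T d f) (h0 : 0 ≤ d 0) (hf : ∀ t ∈ Ioo 0 T, d t < 0 → 0 ≤ f t) {t : ℝ}
    (ht : t ∈ Ico 0 T) : 0 ≤ d t := by
  obtain ⟨t₀, ht₀, hmin⟩ := isCompact_Icc.exists_isMinOn (nonempty_Icc.2 ht.1)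
    (h.continuousOn.mono (Icc_subset_Icc_right ht.2.le))
  refine le_trans ?_ (hmin ⟨ht.1, le_rfl⟩)
  by_contra! hneg
  have ht₀_pos : 0 < t₀ := ht₀.1.lt_of_ne' fun h => hneg.not_ge (h ▸ h0)
  have hγ' : 0 < 1 - γ := sub_pos.2 hγ.2
  have hT : t₀ < T := ht₀.2.trans_lt ht.2
  have hle := fracIntegral_deriv_le_of_forall_le ⟨hγ', by linarith [hγ.1]⟩ ht₀_pos
    (h.continuousOn.mono (Icc_subset_Icc_right hT.le))
    (fun s hs => h.differentiableAt s ⟨hs.1, hs.2.trans_lt hT⟩)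
    (h.intervalIntegrable t₀ ⟨ht₀_pos, hT⟩) fun s hs => hmin ⟨hs.1, hs.2.trans ht₀.2⟩
  rw [h.fracIntegral_deriv t₀ ⟨ht₀_pos, hT⟩] at hle
  exact ((hf t₀ ⟨ht₀_pos, hT⟩ hneg).trans hle).not_gt
    (mul_neg_of_pos_of_neg (fracKernel_pos hγ' ht₀_pos) (by linarith))

end MinimumPrinciple

section MittagLefflerFunction

/-! ### Two-sided bounds for the Mittag-Leffler function -/

variable {γ : ℝ}

theorem fracKernel_mul_pow {t : ℝ} (ht : 0 ≤ t) (x : ℝ) (k : ℕ) :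
    fracKernel (γ * k + 1) t * x ^ k = (x * t ^ γ) ^ k / Real.Gamma (γ * k + 1) := by
  rw [fracKernel, add_sub_cancel_right, Real.rpow_mul ht, Real.rpow_natCast, mul_pow]
  ring

theorem mlSeries_smul_one (x : ℝ) {t : ℝ} (ht : 0 ≤ t) :
    mlSeries γ 1 (x • (1 : ℝ →L[ℝ] ℝ)) 1 t = mittagLeffler γ (x * t ^ γ) := by
  refine tsum_congr fun k => ?_
  rw [← fracKernel_mul_pow ht]
  simp [smul_pow]

theorem continuous_mittagLeffler (hγ : 0 < γ) : Continuous (mittagLeffler γ) := by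
  refine continuous_iff_continuousAt.2 fun x => ?_
  have hcont : ContinuousOn (mittagLeffler γ) (Icc (x - 1) (x + 1)) := by
    refine continuousOn_tsum (fun k => by fun_prop)
      (summable_pow_div_Gamma hγ one_pos (|x| + 1)) fun k y hy => ?_
    have hΓ : 0 < Real.Gamma (γ * k + 1) := Real.Gamma_pos_of_pos (by positivity)
    have hy' : |y| ≤ |x| + 1 := by
      have := abs_sub_abs_le_abs_sub y x
      have : |y - x| ≤ 1 := abs_le.2 ⟨by linarith [hy.1], by linarith [hy.2]⟩
      linarith
    rw [norm_div, Real.norm_of_nonneg hΓ.le, norm_pow, Real.norm_eq_abs]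
    gcongr
  exact hcont.continuousAt (Icc_mem_nhds (by linarith) (by linarith))

theorem mittagLeffler_zero (γ : ℝ) : mittagLeffler γ 0 = 1 := by
  rw [mittagLeffler, tsum_eq_single 0]
  · simp
  · intro k hk
    simp [hk]

theorem hasCaputoDerivOn_mittagLeffler (hγ : γ ∈ Ioo (0 : ℝ) 1) (x : ℝ) {T : ℝ} (hT : 0 < T) :
    HasCaputoDerivOn γ T (fun t => mittagLeffler γ (x * t ^ γ))
      (fun t => x * mittagLeffler γ (x * t ^ γ)) :=
  ((hasCaputoDerivOn_mlSeries hγ (x • (1 : ℝ →L[ℝ] ℝ)) 1 hT).congr_left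
    fun _ ht => mlSeries_smul_one x ht.1).congr_right fun t ht => by
      simp [← mlSeries_smul_one x ht.1.le]

theorem mittagLeffler_neg_nonneg (hγ : γ ∈ Ioo (0 : ℝ) 1) {x : ℝ} (hx : 0 ≤ x) :
    0 ≤ mittagLeffler γ (-x) := by
  have h := (hasCaputoDerivOn_mittagLeffler hγ (-x) two_pos).nonneg hγ
    (by simp [Real.zero_rpow hγ.1.ne', mittagLeffler_zero])
    (fun t _ hneg => mul_nonneg_of_nonpos_of_nonpos (by linarith) hneg.le) (t := 1)
    ⟨zero_le_one, one_lt_two⟩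
  simpa using h

theorem mittagLeffler_neg_antitone (hγ : γ ∈ Ioo (0 : ℝ) 1) :
    AntitoneOn (fun x => mittagLeffler γ (-x)) (Ici 0) := by
  intro x (hx : 0 ≤ x) y (hy : 0 ≤ y) hxy
  have h := ((hasCaputoDerivOn_mittagLeffler hγ (-x) two_pos).sub
    (hasCaputoDerivOn_mittagLeffler hγ (-y) two_pos)).nonneg hγ (by simp [Real.zero_rpow hγ.1.ne'])
    (fun t ht hneg => ?_) (t := 1) ⟨zero_le_one, one_lt_two⟩
  · simpa using h
  · have hE : 0 ≤ mittagLeffler γ (-x * t ^ γ) := by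
      rw [neg_mul]
      exact mittagLeffler_neg_nonneg hγ (mul_nonneg hx (Real.rpow_nonneg ht.1.le _))
    nlinarith [mul_nonneg (sub_nonneg.2 hxy) hE, mul_nonneg hy (neg_nonneg.2 hneg.le)]

theorem mittagLeffler_neg_le_one (hγ : γ ∈ Ioo (0 : ℝ) 1) {x : ℝ} (hx : 0 ≤ x) :
    mittagLeffler γ (-x) ≤ 1 := by
  simpa [mittagLeffler_zero] using mittagLeffler_neg_antitone hγ self_mem_Ici (mem_Ici.2 hx) hx

theorem mittagLeffler_neg_mul_rpow_antitone (hγ : γ ∈ Ioo (0 : ℝ) 1) {x : ℝ} (hx : 0 ≤ x) :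
    AntitoneOn (fun t => mittagLeffler γ (-x * t ^ γ)) (Ici 0) := by
  intro s (hs : 0 ≤ s) t (ht : 0 ≤ t) hst
  simp only [neg_mul]
  exact mittagLeffler_neg_antitone hγ (mul_nonneg hx (Real.rpow_nonneg hs _))
    (mul_nonneg hx (Real.rpow_nonneg ht _))
    (mul_le_mul_of_nonneg_left (Real.rpow_le_rpow hs hst hγ.1.le) hx)

theorem one_le_mul_mittagLeffler (hγ : γ ∈ Ioo (0 : ℝ) 1) {x : ℝ} (hx : 0 ≤ x) :
    1 ≤ (1 + Real.Gamma (1 - γ) * x) * mittagLeffler γ (-x) := by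
  have hΓ : 0 < Real.Gamma (1 - γ) := Real.Gamma_pos_of_pos (sub_pos.2 hγ.2)
  have hE := hasCaputoDerivOn_mittagLeffler hγ (-x) two_pos
  have h1 : (1 : ℝ) ∈ Ioo 0 2 := ⟨one_pos, one_lt_two⟩
  have h := fracIntegral_deriv_le_of_forall_le ⟨sub_pos.2 hγ.2, by linarith [hγ.1]⟩ one_pos
    (hE.continuousOn.mono (Icc_subset_Icc_right one_le_two))
    (fun s hs => hE.differentiableAt s ⟨hs.1, hs.2.trans_lt one_lt_two⟩)
    (hE.intervalIntegrable 1 h1) fun s hs => mittagLeffler_neg_mul_rpow_antitone hγ hx hs.1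
      (mem_Ici.2 zero_le_one) hs.2
  simp only [hE.fracIntegral_deriv 1 h1, fracKernel_one_right, Real.one_rpow, mul_one,
    Real.zero_rpow hγ.1.ne', mul_zero, mittagLeffler_zero] at h
  rw [inv_mul_eq_div, le_div_iff₀ hΓ] at h
  linarith

theorem mittagLeffler_neg_pos (hγ : γ ∈ Ioo (0 : ℝ) 1) {x : ℝ} (hx : 0 ≤ x) :
    0 < mittagLeffler γ (-x) := by
  have hΓ : 0 < Real.Gamma (1 - γ) := Real.Gamma_pos_of_pos (sub_pos.2 hγ.2)
  exact pos_of_mul_pos_right (zero_lt_one.trans_le (one_le_mul_mittagLeffler hγ hx)) (by positivity)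

theorem mul_mittagLeffler_le_one (hγ : γ ∈ Ioo (0 : ℝ) 1) {x : ℝ} (hx : 0 ≤ x) :
    (1 + x / Real.Gamma (γ + 1)) * mittagLeffler γ (-x) ≤ 1 := by
  set E : ℝ → ℝ := fun t => mittagLeffler γ (-x * t ^ γ)
  have hE : HasCaputoDerivOn γ 2 E fun t => -x * E t :=
    hasCaputoDerivOn_mittagLeffler hγ (-x) two_pos
  have hE0 : E 0 = 1 := by simp [E, Real.zero_rpow hγ.1.ne', mittagLeffler_zero]
  have hE1 : E 1 = mittagLeffler γ (-x) := by simp [E]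
  have hcont : ContinuousOn (fun t => -x * E t) (Icc 0 1) :=
    continuousOn_const.mul (hE.continuousOn.mono (Icc_subset_Icc_right one_le_two))
  have hmono : fracIntegral γ (fun t => -x * E t) 1 ≤ fracIntegral γ (fun _ => -x * E 1) 1 := by
    refine intervalIntegral.integral_mono_on zero_le_one
      (intervalIntegrable_fracKernel_smul hγ.1 one_pos hcont)
      (intervalIntegrable_fracKernel_smul hγ.1 one_pos continuousOn_const) fun s hs => ?_
    refine smul_le_smul_of_nonneg_left (mul_le_mul_of_nonpos_left ?_ (neg_nonpos.2 hx))
      (fracKernel_nonneg hγ.1.le (sub_nonneg.2 hs.2))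
    exact mittagLeffler_neg_mul_rpow_antitone hγ hx hs.1 (mem_Ici.2 zero_le_one) hs.2
  have hconst : fracIntegral γ (fun _ => -x * E 1) 1 = (Real.Gamma (γ + 1))⁻¹ * (-x * E 1) := by
    have h := fracIntegral_fracKernel hγ.1 one_pos one_pos
    simp only [fracIntegral, fracKernel_one_left, smul_eq_mul, mul_one] at h
    simp only [fracIntegral, smul_eq_mul, intervalIntegral.integral_mul_const, h,
      fracKernel_one_right]
  rw [← hE.sub_eq_fracIntegral hγ ⟨one_pos, one_lt_two⟩, hconst, hE0, hE1] at hmono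
  rw [div_eq_mul_inv]
  linarith

end MittagLefflerFunction

section MultiplicationOperators

/-! ### Multiplication operators -/

variable {α H : Type*} [MeasurableSpace α] {μ : Measure α} [NormedAddCommGroup H] {p : ℝ≥0∞}
  [Fact (1 ≤ p)]

theorem ae_eq_of_hasSum_Lp {F : ℕ → Lp H p μ} {f : Lp H p μ} (hF : HasSum F f) {G : ℕ → α → H}
    {g : α → H} (hFG : ∀ k, F k =ᵐ[μ] G k) (hG : ∀ᵐ x ∂μ, HasSum (fun k => G k x) (g x)) :
    f =ᵐ[μ] g := by
  have hpartial (K : ℕ) :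
      ∀ᵐ x ∂μ, (∑ k ∈ Finset.range K, F k : Lp H p μ) x = ∑ k ∈ Finset.range K, G k x := by
    induction K with
    | zero => filter_upwards [Lp.coeFn_zero H p μ] with x hx using by simpa using hx
    | succ K ih =>
      filter_upwards [ih, hFG K, Lp.coeFn_add (∑ k ∈ Finset.range K, F k) (F K)] with x hx hK hadd
      rw [Finset.sum_range_succ, hadd, Pi.add_apply, hx, hK, Finset.sum_range_succ]
  obtain ⟨ns, hns, hlim⟩ :=
    (tendstoInMeasure_of_tendsto_Lp hF.tendsto_sum_nat).exists_seq_tendsto_ae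
  filter_upwards [hlim, hG, ae_all_iff.2 hpartial] with x hx hGx hpx
  simp only [hpx] at hx
  exact tendsto_nhds_unique hx (hGx.tendsto_sum_nat.comp hns.tendsto_atTop)

variable [NormedSpace ℝ H]

/-- Multiplication by an essentially bounded function, as a bounded operator on `Lᵖ`. -/
def mulOp {m : α → ℝ} (hm : MemLp m ∞ μ) : Lp H p μ →L[ℝ] Lp H p μ :=
  (ContinuousLinearMap.lsmul ℝ ℝ).holderL μ ∞ p p (hm.toLp m)

variable {m : α → ℝ} (hm : MemLp m ∞ μ)

theorem coeFn_mulOp (f : Lp H p μ) : mulOp hm f =ᵐ[μ] fun x => m x • f x := by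
  filter_upwards [(ContinuousLinearMap.lsmul ℝ ℝ).coeFn_holder (r := p) (hm.toLp m) f,
    hm.coeFn_toLp] with x hx hmx
  exact hx.trans (by rw [hmx]; rfl)

theorem coeFn_mulOp_pow (f : Lp H p μ) (k : ℕ) :
    ((mulOp hm) ^ k) f =ᵐ[μ] fun x => m x ^ k • f x := by
  induction k with
  | zero => simp
  | succ k ih =>
    filter_upwards [ih, coeFn_mulOp hm (((mulOp hm) ^ k) f)] with x hx hmul
    rw [pow_succ', mul_apply_eq_comp, hmul, hx, smul_smul, ← pow_succ']

theorem coeFn_mlSeries_mulOp [CompleteSpace H] {γ t : ℝ} (hγ : 0 < γ) (ht : 0 ≤ t)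
    (f : Lp H p μ) :
    (mlSeries γ 1 (mulOp hm) f t : Lp H p μ) =ᵐ[μ]
      fun x => mittagLeffler γ (m x * t ^ γ) • f x := by
  rcases ht.eq_or_lt with rfl | ht
  · simp [mlSeries_zero hγ, Real.zero_rpow hγ.ne', mittagLeffler_zero]
  refine ae_eq_of_hasSum_Lp (hasSum_mlSeries hγ one_pos (mulOp hm) f ht)
    (G := fun k x => ((m x * t ^ γ) ^ k / Real.Gamma (γ * k + 1)) • f x) (fun k => ?_)
    (ae_of_all _ fun x => (summable_pow_div_Gamma hγ one_pos _).hasSum.smul_const (f x))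
  filter_upwards [coeFn_mulOp_pow hm f k, Lp.coeFn_smul (fracKernel (γ * k + 1) t)
    (((mulOp hm) ^ k) f)] with x hx hsmul
  rw [hsmul, Pi.smul_apply, hx, smul_smul, fracKernel_mul_pow ht.le]

end MultiplicationOperators

section FourierSide

/-! ### The equation on the Fourier side -/

variable {n : ℕ} {γ T : ℝ}

@[fun_prop]
theorem measurable_freq : Measurable (freq : Rn n → Rn n) := by
  unfold freq
  fun_prop

theorem fracKernel_one_sub (t : ℝ) :
    fracKernel (1 - γ) t = (1 / Real.Gamma (1 - γ)) * t ^ (-γ) := by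
  rw [fracKernel, sub_sub_cancel_left, one_div_mul_eq_div]

theorem caputoDeriv_eq_fracIntegral (u : ℝ → L2 n) (t : ℝ) :
    caputoDeriv γ u t = fracIntegral (1 - γ) (deriv u) t := by
  simp only [caputoDeriv, fracIntegral, fracKernel_one_sub, mul_smul,
    intervalIntegral.integral_smul]

theorem intervalIntegrable_rpow_smul_iff (hγ : γ < 1) (w : ℝ → L2 n) (t : ℝ) :
    IntervalIntegrable (fun s => (t - s) ^ (-γ) • w s) volume 0 t ↔
      IntervalIntegrable (fun s => fracKernel (1 - γ) (t - s) • w s) volume 0 t := by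
  have hΓ : 1 / Real.Gamma (1 - γ) ≠ 0 :=
    one_div_ne_zero (Real.Gamma_pos_of_pos (sub_pos.2 hγ)).ne'
  simp only [fracKernel_one_sub, mul_smul, intervalIntegrable_iff, IntegrableOn]
  exact (integrable_smul_iff hΓ _).symm

theorem IsSolution.hasCaputoDerivOn (hγ : γ < 1) {g : L2 n} {u : ℝ → L2 n}
    (hu : IsSolution γ T g u) : HasCaputoDerivOn γ T u (caputoDeriv γ u) where
  continuousOn := hu.continuousOn
  differentiableAt := hu.differentiableAt
  intervalIntegrable t ht := (intervalIntegrable_rpow_smul_iff hγ _ t).1 (hu.integrable t ht)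
  fracIntegral_deriv t _ := (caputoDeriv_eq_fracIntegral u t).symm

theorem laplacian_eq_fourierInv (f : L2 n)
    (hf : MemLp (fun η => ((-‖freq η‖ ^ 2 : ℝ) : ℂ) * (𝓕 f : L2 n) η) 2 volume) :
    Δ (f : 𝓢'(Rn n, ℂ)) = ((𝓕⁻ (hf.toLp _ : L2 n) : L2 n) : 𝓢'(Rn n, ℂ)) := by
  have hgrowth : (fun x : Rn n => Complex.ofReal (‖x‖ ^ 2)).HasTemperateGrowth := by fun_prop
  rw [TemperedDistribution.laplacian_eq_fourierMultiplierCLM,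
    TemperedDistribution.fourierMultiplierCLM_apply, Lp.fourier_toTemperedDistribution_eq,
    ← Lp.fourierInv_toTemperedDistribution_eq, ← Complex.coe_smul,
    ← FourierTransform.fourierInv_smul]
  congr 1
  ext φ
  rw [Lp.toTemperedDistribution_apply, smul_apply,
    TemperedDistribution.smulLeftCLM_apply_apply, Lp.toTemperedDistribution_apply,
    ← integral_smul]
  refine integral_congr_ae ?_
  filter_upwards [hf.coeFn_toLp] with η hη
  rw [hη, SchwartzMap.smulLeftCLM_apply_apply hgrowth]
  simp only [freq, norm_smul, smul_eq_mul]
  rw [Real.norm_of_nonneg (by positivity)]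
  push_cast
  ring

theorem coe_eq_laplacian_iff {f h : L2 n}
    (hf : MemLp (fun η => ((-‖freq η‖ ^ 2 : ℝ) : ℂ) * (𝓕 f : L2 n) η) 2 volume) :
    (h : 𝓢'(Rn n, ℂ)) = Δ (f : 𝓢'(Rn n, ℂ)) ↔
      (𝓕 h : L2 n) =ᵐ[volume] fun η => ((-‖freq η‖ ^ 2 : ℝ) : ℂ) * (𝓕 f : L2 n) η := by
  have hinj : Function.Injective (Lp.toTemperedDistributionCLM ℂ (volume : Measure (Rn n)) 2) :=
    LinearMap.ker_eq_bot.1 Lp.ker_toTemperedDistributionCLM_eq_bot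
  rw [laplacian_eq_fourierInv f hf]
  refine ⟨fun heq => ?_, fun hae => ?_⟩
  · rw [hinj heq, FourierTransform.fourier_fourierInv_eq]
    exact hf.coeFn_toLp
  · rw [← Lp.ext (hae.trans hf.coeFn_toLp.symm), FourierTransform.fourierInv_fourier_eq]

theorem aestronglyMeasurable_ofReal_mul {m : Rn n → ℝ} (hm : Measurable m) (f : L2 n) :
    AEStronglyMeasurable (fun η => (m η : ℂ) * f η) volume :=
  (Complex.measurable_ofReal.comp hm).aestronglyMeasurable.mul (Lp.aestronglyMeasurable f)

theorem memLp_of_sobolevNorm_two_lt_top {f : L2 n} (hf : sobolevNorm 2 f < ∞) :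
    MemLp (fun η => ((-‖freq η‖ ^ 2 : ℝ) : ℂ) * (𝓕 f : L2 n) η) 2 volume := by
  have hsob : MemLp (fun η : Rn n => (((1 + ‖freq η‖ ^ 2) ^ ((2 : ℝ) / 2) : ℝ) : ℂ) *
      (𝓕 f : L2 n) η) 2 volume :=
    ⟨aestronglyMeasurable_ofReal_mul (by fun_prop) _, hf⟩
  refine hsob.mono (aestronglyMeasurable_ofReal_mul (by fun_prop) _) (ae_of_all _ fun η => ?_)
  rw [norm_mul, norm_mul, Complex.norm_real, Complex.norm_real, div_self two_ne_zero,
    Real.rpow_one, norm_neg, Real.norm_of_nonneg (by positivity),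
    Real.norm_of_nonneg (by positivity)]
  gcongr
  linarith

/-- The frequencies `|ξ| ≤ N`. -/
def lowFreq (N : ℝ) : Set (Rn n) := {η | ‖freq η‖ ≤ N}

theorem measurableSet_lowFreq (N : ℝ) : MeasurableSet (lowFreq N : Set (Rn n)) :=
  measurableSet_le (by fun_prop) measurable_const

theorem memLp_indicator_lowFreq_one (N : ℝ) :
    MemLp ((lowFreq N : Set (Rn n)).indicator fun _ => (1 : ℝ)) ∞ volume :=
  (memLp_top_const 1).indicator (measurableSet_lowFreq N)

theorem memLp_indicator_lowFreq_neg_sq (N : ℝ) :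
    MemLp ((lowFreq N : Set (Rn n)).indicator fun η => -‖freq η‖ ^ 2) ∞ volume := by
  have hmeas : Measurable fun η : Rn n => -‖freq η‖ ^ 2 := by fun_prop
  refine memLp_top_of_bound (hmeas.indicator (measurableSet_lowFreq N)).aestronglyMeasurable
    (N ^ 2) (ae_of_all _ fun η => ?_)
  by_cases hη : η ∈ lowFreq N
  · rw [indicator_of_mem hη, norm_neg, norm_pow, norm_norm]
    exact pow_le_pow_left₀ (norm_nonneg _) hη 2
  · simpa [indicator_of_notMem hη] using sq_nonneg N

/-- Restriction to the frequencies `|ξ| ≤ N`, on the Fourier side. -/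
def lowPass (N : ℝ) : L2 n →L[ℝ] L2 n := mulOp (memLp_indicator_lowFreq_one N)

/-- The Laplacian restricted to the frequencies `|ξ| ≤ N`, on the Fourier side. -/
def truncLaplacian (N : ℝ) : L2 n →L[ℝ] L2 n := mulOp (memLp_indicator_lowFreq_neg_sq N)

theorem coeFn_lowPass (N : ℝ) (f : L2 n) : lowPass N f =ᵐ[volume] (lowFreq N).indicator f := by
  filter_upwards [coeFn_mulOp (memLp_indicator_lowFreq_one N) f] with η hη
  rw [lowPass, hη]
  by_cases hmem : η ∈ lowFreq N <;> simp [hmem]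

theorem coeFn_truncLaplacian (N : ℝ) (f : L2 n) :
    truncLaplacian N f =ᵐ[volume]
      (lowFreq N).indicator fun η => ((-‖freq η‖ ^ 2 : ℝ) : ℂ) * f η := by
  filter_upwards [coeFn_mulOp (memLp_indicator_lowFreq_neg_sq N) f] with η hη
  rw [truncLaplacian, hη]
  by_cases hmem : η ∈ lowFreq N <;> simp [hmem]

/-- `w` vanishes at the frequencies `|ξ| > N` (`w` itself lives on the Fourier side). -/
def BandLimited (N : ℝ) (w : L2 n) : Prop := ∀ᵐ η, η ∉ lowFreq N → w η = 0

theorem bandLimited_lowPass (N : ℝ) (f : L2 n) : BandLimited N (lowPass N f) := by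
  filter_upwards [coeFn_lowPass N f] with η hη hmem
  rw [hη, indicator_of_notMem hmem]

namespace BandLimited

variable {N : ℝ} {v w : L2 n}

theorem sub (hv : BandLimited N v) (hw : BandLimited N w) : BandLimited N (v - w) := by
  filter_upwards [hv, hw, Lp.coeFn_sub v w] with η hvη hwη hsub hη
  rw [hsub, Pi.sub_apply, hvη hη, hwη hη, sub_zero]

theorem coeFn_truncLaplacian (hw : BandLimited N w) :
    truncLaplacian N w =ᵐ[volume] fun η => ((-‖freq η‖ ^ 2 : ℝ) : ℂ) * w η := by
  filter_upwards [hw, FracDiffusion.coeFn_truncLaplacian N w] with η hwη hη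
  rw [hη]
  by_cases hmem : η ∈ lowFreq N
  · rw [indicator_of_mem hmem]
  · rw [indicator_of_notMem hmem, hwη hmem, mul_zero]

theorem coeFn_mlSeries (hw : BandLimited N w) (hγ : 0 < γ) {t : ℝ} (ht : 0 ≤ t) :
    (mlSeries γ 1 (truncLaplacian N) w t : L2 n) =ᵐ[volume]
      fun η => (mittagLeffler γ (-‖freq η‖ ^ 2 * t ^ γ) : ℂ) * w η := by
  filter_upwards [hw, coeFn_mlSeries_mulOp (memLp_indicator_lowFreq_neg_sq N) hγ ht w] with η hwη hη
  rw [truncLaplacian, hη, Complex.real_smul]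
  by_cases hmem : η ∈ lowFreq N
  · rw [indicator_of_mem hmem]
  · rw [hwη hmem, mul_zero, mul_zero]

theorem mlSeries (hw : BandLimited N w) (hγ : 0 < γ) {t : ℝ} (ht : 0 ≤ t) :
    BandLimited N (mlSeries γ 1 (truncLaplacian N) w t) := by
  filter_upwards [hw, hw.coeFn_mlSeries hγ ht] with η hwη hη hmem
  rw [hη, hwη hmem, mul_zero]

end BandLimited

theorem IsSolution.hasCaputoDerivOn_lowPass (hγ : γ < 1) {g : L2 n} {u : ℝ → L2 n}
    (hu : IsSolution γ T g u) (N : ℝ) :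
    HasCaputoDerivOn γ T (fun t => lowPass N (𝓕 (u t) : L2 n))
      (fun t => truncLaplacian N (lowPass N (𝓕 (u t) : L2 n))) := by
  refine ((hu.hasCaputoDerivOn hγ).clm_comp ((lowPass N).comp
    ((FourierTransform.fourierCLM ℂ (L2 n)).restrictScalars ℝ))).congr_right fun t ht => ?_
  have hfourier := (coe_eq_laplacian_iff (memLp_of_sobolevNorm_two_lt_top
    (hu.mem_H2 t ⟨ht.1, ht.2.le⟩))).1 (hu.equation t ht)
  refine Lp.ext ?_
  change (lowPass N (𝓕 (caputoDeriv γ u t) : L2 n) : Rn n → ℂ) =ᵐ[volume] _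
  filter_upwards [hfourier, coeFn_lowPass N (𝓕 (caputoDeriv γ u t) : L2 n),
    coeFn_lowPass N (𝓕 (u t) : L2 n), coeFn_truncLaplacian N (lowPass N (𝓕 (u t) : L2 n))]
    with η hη hl hr hΔ
  rw [hl, hΔ]
  by_cases hmem : η ∈ lowFreq N
  · rw [indicator_of_mem hmem, indicator_of_mem hmem, hr, indicator_of_mem hmem, hη]
  · rw [indicator_of_notMem hmem, indicator_of_notMem hmem]

theorem IsSolution.fourier_eq (hγ : γ ∈ Ioo (0 : ℝ) 1) {g : L2 n} {u : ℝ → L2 n}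
    (hu : IsSolution γ T g u) {t : ℝ} (hT : 0 < T) (ht : t ∈ Icc 0 T) :
    (𝓕 (u t) : L2 n) =ᵐ[volume] fun η =>
      (mittagLeffler γ (-‖freq η‖ ^ 2 * t ^ γ) : ℂ) * (𝓕 (u 0) : L2 n) η := by
  have hlow (N : ℕ) : ∀ᵐ η : Rn n, η ∈ lowFreq N → (𝓕 (u t) : L2 n) η =
      (mittagLeffler γ (-‖freq η‖ ^ 2 * t ^ γ) : ℂ) * (𝓕 (u 0) : L2 n) η := by
    have heq := (hu.hasCaputoDerivOn_lowPass hγ.2 N).eqOn_mlSeries hγ hT ht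
    have hml := (bandLimited_lowPass N (𝓕 (u 0) : L2 n)).coeFn_mlSeries hγ.1 ht.1
    rw [← heq] at hml
    filter_upwards [hml, coeFn_lowPass N (𝓕 (u t) : L2 n), coeFn_lowPass N (𝓕 (u 0) : L2 n)]
      with η hη ht h0 hmem
    rwa [ht, h0, indicator_of_mem hmem, indicator_of_mem hmem] at hη
  filter_upwards [ae_all_iff.2 hlow] with η hη
  obtain ⟨N, hN⟩ := exists_nat_ge ‖freq η‖
  exact hη N hN

end FourierSide

section BandLimitedSolutions

/-! ### Band-limited solutions -/

variable {n : ℕ} {N γ T : ℝ} {w : L2 n}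

namespace BandLimited

theorem sobolevNorm_fourierInv_le {l : ℝ} (hl : 0 ≤ l) (hw : BandLimited N w) :
    sobolevNorm l (𝓕⁻ w : L2 n) ≤ ENNReal.ofReal ((1 + N ^ 2) ^ (l / 2)) * ‖w‖ₑ := by
  rw [sobolevNorm, FourierTransform.fourier_fourierInv_eq, Lp.enorm_def]
  refine eLpNorm_le_mul_eLpNorm_of_ae_le_mul ?_ 2
  filter_upwards [hw] with η hη
  by_cases hmem : η ∈ lowFreq N
  · have hle : ‖freq η‖ ≤ N := hmem
    rw [norm_mul, Complex.norm_real, Real.norm_of_nonneg (by positivity)]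
    gcongr
  · simp [hη hmem]

theorem sobolevNorm_fourierInv_lt_top {l : ℝ} (hl : 0 ≤ l) (hw : BandLimited N w) :
    sobolevNorm l (𝓕⁻ w : L2 n) < ∞ :=
  (hw.sobolevNorm_fourierInv_le hl).trans_lt
    (ENNReal.mul_lt_top ENNReal.ofReal_lt_top enorm_lt_top)

theorem tendsto_sobolevNorm_fourierInv_sub {l t : ℝ} {s : Set ℝ} {v : ℝ → L2 n} (hl : 0 ≤ l)
    (hv : ContinuousWithinAt v s t) (hband : ∀ r ∈ s, BandLimited N (v r)) (ht : t ∈ s) :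
    Tendsto (fun r => sobolevNorm l ((𝓕⁻ (v r) : L2 n) - (𝓕⁻ (v t) : L2 n))) (𝓝[s] t) (𝓝 0) := by
  have hnorm : Tendsto (fun r => ‖v r - v t‖ₑ) (𝓝[s] t) (𝓝 0) := by
    simpa using (hv.tendsto.sub_const (v t)).enorm
  have hlim : Tendsto (fun r => ENNReal.ofReal ((1 + N ^ 2) ^ (l / 2)) * ‖v r - v t‖ₑ)
      (𝓝[s] t) (𝓝 0) := by
    simpa using ENNReal.Tendsto.const_mul hnorm (Or.inr ENNReal.ofReal_ne_top)
  refine tendsto_of_tendsto_of_tendsto_of_le_of_le' tendsto_const_nhds hlim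
    (Eventually.of_forall fun _ => zero_le) ?_
  filter_upwards [self_mem_nhdsWithin] with r hr
  have hsub : (𝓕⁻ (v r) : L2 n) - (𝓕⁻ (v t) : L2 n) = (𝓕⁻ (v r - v t) : L2 n) :=
    (map_sub (FourierTransform.fourierInvCLM ℂ (L2 n)) (v r) (v t)).symm
  rw [hsub]
  exact ((hband r hr).sub (hband t ht)).sobolevNorm_fourierInv_le hl

theorem coe_fourierInv_truncLaplacian (hw : BandLimited N w) :
    ((𝓕⁻ (truncLaplacian N w) : L2 n) : 𝓢'(Rn n, ℂ)) = Δ ((𝓕⁻ w : L2 n) : 𝓢'(Rn n, ℂ)) := by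
  rw [coe_eq_laplacian_iff
      (memLp_of_sobolevNorm_two_lt_top (hw.sobolevNorm_fourierInv_lt_top zero_le_two)),
    FourierTransform.fourier_fourierInv_eq, FourierTransform.fourier_fourierInv_eq]
  exact hw.coeFn_truncLaplacian

end BandLimited

theorem HasCaputoDerivOn.isSolution (hγ : γ < 1) {u f : ℝ → L2 n} (hu : HasCaputoDerivOn γ T u f)
    (hmem : ∀ t ∈ Ioc 0 T, sobolevNorm 2 (u t) < ∞)
    (hcont : ∀ t ∈ Ioc 0 T, Tendsto (fun r => sobolevNorm 2 (u r - u t)) (𝓝[Ioc 0 T] t) (𝓝 0))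
    (heq : ∀ t ∈ Ioo 0 T, (f t : 𝓢'(Rn n, ℂ)) = Δ (u t : 𝓢'(Rn n, ℂ))) :
    IsSolution γ T (u T) u where
  continuousOn := hu.continuousOn
  mem_H2 := hmem
  continuous_H2 := hcont
  differentiableAt := hu.differentiableAt
  integrable t ht := (intervalIntegrable_rpow_smul_iff hγ _ t).2 (hu.intervalIntegrable t ht)
  equation t ht := by rw [caputoDeriv_eq_fracIntegral, hu.fracIntegral_deriv t ht, heq t ht]
  final := rfl

theorem BandLimited.isSolution (hγ : γ ∈ Ioo (0 : ℝ) 1) (hT : 0 < T) (hw : BandLimited N w) :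
    IsSolution γ T (𝓕⁻ (FracDiffusion.mlSeries γ 1 (truncLaplacian N) w T) : L2 n)
      (fun t => (𝓕⁻ (FracDiffusion.mlSeries γ 1 (truncLaplacian N) w t) : L2 n)) := by
  have hband {t : ℝ} (ht : t ∈ Ioc 0 T) :
      BandLimited N (FracDiffusion.mlSeries γ 1 (truncLaplacian N) w t) :=
    hw.mlSeries hγ.1 ht.1.le
  have hcaputo := (hasCaputoDerivOn_mlSeries hγ (truncLaplacian N) w hT).clm_comp
    ((FourierTransform.fourierInvCLM ℂ (L2 n)).restrictScalars ℝ)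
  refine hcaputo.isSolution hγ.2
    (fun t ht => (hband ht).sobolevNorm_fourierInv_lt_top zero_le_two)
    (fun t ht => BandLimited.tendsto_sobolevNorm_fourierInv_sub zero_le_two
      ((continuousOn_mlSeries hγ.1 le_rfl _ w hT t (Ioc_subset_Icc_self ht)).mono
        Ioc_subset_Icc_self) (fun r hr => hband hr) ht)
    fun t ht => (hband (Ioo_subset_Ioc_self ht)).coe_fourierInv_truncLaplacian

end BandLimitedSolutions

section RealEstimates

/-! ### Estimates for the mollifier -/

theorem sq_rpow_half {x : ℝ} (hx : 0 ≤ x) (q : ℝ) : (x ^ 2) ^ (q / 2) = x ^ q := by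
  rw [← Real.rpow_two, ← Real.rpow_mul hx, mul_div_cancel₀ _ two_ne_zero]

theorem tendsto_rpow_mul_exp_neg_mul_rpow_atTop {M q τ s : ℝ} (hM : 0 ≤ M) (hq : 0 ≤ q)
    (hτ : 0 < τ) (hs : 0 < s) :
    Tendsto (fun y : ℝ => (M + y ^ 2) ^ q * Real.exp (-τ * y ^ s)) atTop (𝓝 0) := by
  have hlim := ((tendsto_rpow_mul_exp_neg_mul_atTop_nhds_zero (2 * q / s) τ hτ).comp
    (tendsto_rpow_atTop hs)).const_mul ((M + 1) ^ q)
  rw [mul_zero] at hlim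
  refine tendsto_of_tendsto_of_tendsto_of_le_of_le' tendsto_const_nhds hlim
    (Eventually.of_forall fun y => by positivity) ?_
  filter_upwards [eventually_ge_atTop 1] with y hy
  have hy0 : 0 ≤ y := zero_le_one.trans hy
  have hpow : (y ^ s) ^ (2 * q / s) = (y ^ 2) ^ q := by
    rw [← Real.rpow_mul hy0, mul_div_cancel₀ _ hs.ne', Real.rpow_mul hy0, Real.rpow_two]
  have hle : M + y ^ 2 ≤ (M + 1) * y ^ 2 := by nlinarith [one_le_pow₀ (n := 2) hy]
  simp only [Function.comp_apply, hpow]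
  rw [← mul_assoc, ← Real.mul_rpow (by positivity) (by positivity)]
  gcongr

theorem exists_forall_rpow_mul_exp_neg_mul_rpow_le {M q τ s : ℝ} (hM : 0 < M) (hq : 0 ≤ q)
    (hτ : 0 < τ) (hs : 0 < s) :
    ∃ C : ℝ, 0 < C ∧ ∀ y : ℝ, 0 ≤ y → (M + y ^ 2) ^ q * Real.exp (-τ * y ^ s) ≤ C := by
  set f : ℝ → ℝ := fun y => (M + |y| ^ 2) ^ q * Real.exp (-τ * |y| ^ s) with hf
  have hpos (y : ℝ) : 0 < f y := by positivity
  have hcont : Continuous f :=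
    ((continuous_const.add (continuous_abs.pow 2)).rpow_const fun _ => Or.inr hq).mul
      (Real.continuous_exp.comp (continuous_const.mul
        (continuous_abs.rpow_const fun _ => Or.inr hs.le)))
  have hlim : Tendsto f (cocompact ℝ) (𝓝 0) :=
    (tendsto_rpow_mul_exp_neg_mul_rpow_atTop hM.le hq hτ hs).comp tendsto_norm_cocompact_atTop
  obtain ⟨y₀, hy₀⟩ := hcont.exists_forall_ge' 0 (hlim.eventually_le_const (hpos 0))
  exact ⟨f y₀, hpos y₀, fun y hy => by simpa only [hf, abs_of_nonneg hy] using hy₀ y⟩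

theorem exists_sobolevWeight_mul_exp_le {Q τ s : ℝ} (hQ : 0 ≤ Q) (hτ : 0 < τ) (hs : 0 < s)
    (α₀ : ℝ) :
    ∃ C : ℝ, 0 < C ∧ ∀ α ∈ Ioc 0 α₀, ∀ q ∈ Icc 0 Q, ∀ x : ℝ, 0 ≤ x →
      (1 + x ^ 2) ^ (q / 2) * Real.exp (-τ * (α * x) ^ s) ≤ C * α ^ (-q) := by
  obtain ⟨C, hC, hbound⟩ := exists_forall_rpow_mul_exp_neg_mul_rpow_le (M := 1 + α₀ ^ 2)
    (q := Q / 2) (by positivity) (by positivity) hτ hs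
  refine ⟨C, hC, fun α ⟨hα, hα₀⟩ q ⟨hq, hqQ⟩ x hx => ?_⟩
  have hscale : α ^ q * (1 + x ^ 2) ^ (q / 2) = (α ^ 2 * (1 + x ^ 2)) ^ (q / 2) := by
    rw [Real.mul_rpow (by positivity) (by positivity), sq_rpow_half hα.le]
  have hsq : α ^ 2 * (1 + x ^ 2) ≤ 1 + α₀ ^ 2 + (α * x) ^ 2 := by
    nlinarith [pow_le_pow_left₀ hα.le hα₀ 2]
  have hone : 1 ≤ 1 + α₀ ^ 2 + (α * x) ^ 2 := by nlinarith [sq_nonneg (α * x), sq_nonneg α₀]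
  rw [Real.rpow_neg hα.le, ← div_eq_mul_inv, le_div_iff₀' (by positivity), ← mul_assoc, hscale]
  calc (α ^ 2 * (1 + x ^ 2)) ^ (q / 2) * Real.exp (-τ * (α * x) ^ s)
      ≤ (1 + α₀ ^ 2 + (α * x) ^ 2) ^ (Q / 2) * Real.exp (-τ * (α * x) ^ s) := by
        gcongr ?_ * _
        exact (Real.rpow_le_rpow (by positivity) hsq (by positivity)).trans
          (Real.rpow_le_rpow_of_exponent_le hone (by linarith))
    _ ≤ C := hbound _ (by positivity)

theorem one_sub_exp_neg_le_rpow {z θ : ℝ} (hz : 0 ≤ z) (hθ : θ ∈ Icc (0 : ℝ) 1) :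
    1 - Real.exp (-z) ≤ z ^ θ := by
  rcases le_total z 1 with hz1 | hz1
  · calc 1 - Real.exp (-z) ≤ z := by linarith [Real.add_one_le_exp (-z)]
      _ ≤ z ^ θ := Real.self_le_rpow_of_le_one hz hz1 hθ.2
  · linarith [Real.one_le_rpow hz1 hθ.1, Real.exp_pos (-z)]

theorem rpow_le_max_one {τ θ : ℝ} (hτ : 0 ≤ τ) (hθ : θ ∈ Icc (0 : ℝ) 1) : τ ^ θ ≤ max 1 τ := by
  rcases le_total τ 1 with h | h
  · exact (Real.rpow_le_one hτ h hθ.1).trans (le_max_left _ _)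
  · exact (Real.rpow_le_self_of_one_le h hθ.2).trans (le_max_right _ _)

theorem rpow_le_one_add_sq_rpow {x q : ℝ} (hx : 0 ≤ x) (hq : 0 ≤ q) :
    x ^ q ≤ (1 + x ^ 2) ^ (q / 2) := by
  rw [← sq_rpow_half hx]
  gcongr
  exact le_add_of_nonneg_left zero_le_one

theorem sobolevWeight_mul_one_sub_exp_le {τ s p l α x : ℝ} (hτ : 0 < τ) (hs : 0 < s) (hlp : l ≤ p)
    (hls : p - l ≤ s) (hα : 0 ≤ α) (hx : 0 ≤ x) :
    (1 + x ^ 2) ^ (l / 2) * (1 - Real.exp (-τ * (α * x) ^ s)) ≤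
      max 1 τ * α ^ (p - l) * (1 + x ^ 2) ^ (p / 2) := by
  have hθ : (p - l) / s ∈ Icc (0 : ℝ) 1 := ⟨div_nonneg (by linarith) hs.le, (div_le_one hs).2 hls⟩
  have hexp : 1 - Real.exp (-τ * (α * x) ^ s) ≤
      max 1 τ * (α ^ (p - l) * (1 + x ^ 2) ^ ((p - l) / 2)) := by
    calc 1 - Real.exp (-τ * (α * x) ^ s) ≤ (τ * (α * x) ^ s) ^ ((p - l) / s) := by
          rw [neg_mul]
          exact one_sub_exp_neg_le_rpow (by positivity) hθ
      _ = τ ^ ((p - l) / s) * (α ^ (p - l) * x ^ (p - l)) := by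
          rw [Real.mul_rpow hτ.le (by positivity), ← Real.rpow_mul (by positivity),
            mul_div_cancel₀ _ hs.ne', Real.mul_rpow hα hx]
      _ ≤ max 1 τ * (α ^ (p - l) * (1 + x ^ 2) ^ ((p - l) / 2)) := by
          gcongr
          · exact rpow_le_max_one hτ.le hθ
          · exact rpow_le_one_add_sq_rpow hx (by linarith)
  calc (1 + x ^ 2) ^ (l / 2) * (1 - Real.exp (-τ * (α * x) ^ s))
      ≤ (1 + x ^ 2) ^ (l / 2) * (max 1 τ * (α ^ (p - l) * (1 + x ^ 2) ^ ((p - l) / 2))) := by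
        gcongr
    _ = max 1 τ * α ^ (p - l) * ((1 + x ^ 2) ^ (l / 2) * (1 + x ^ 2) ^ ((p - l) / 2)) := by ring
    _ = max 1 τ * α ^ (p - l) * (1 + x ^ 2) ^ (p / 2) := by
        rw [← Real.rpow_add (by positivity), ← add_div, add_sub_cancel]

end RealEstimates

section SobolevNorm

/-! ### Sobolev norms and Fourier multipliers -/

variable {n : ℕ}

theorem sobolevNorm_zero (f : L2 n) : sobolevNorm 0 f = ‖f‖ₑ := by
  have hplancherel : ‖(𝓕 f : L2 n)‖ₑ = ‖f‖ₑ := by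
    rw [enorm_eq_iff_norm_eq, Lp.norm_fourier_eq]
  simp [sobolevNorm, ← hplancherel, Lp.enorm_def]

theorem sobolevNorm_sub_le (l : ℝ) (f g h : L2 n) :
    sobolevNorm l (f - h) ≤ sobolevNorm l (f - g) + sobolevNorm l (g - h) := by
  have hmeas (v : L2 n) : AEStronglyMeasurable
      (fun η => (((1 + ‖freq η‖ ^ 2) ^ (l / 2) : ℝ) : ℂ) * (𝓕 v : L2 n) η) volume :=
    aestronglyMeasurable_ofReal_mul (by fun_prop) _
  refine (eLpNorm_congr_ae ?_).trans_le
    (eLpNorm_add_le (hmeas (f - g)) (hmeas (g - h)) one_le_two)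
  have hadd : (𝓕 (f - h) : L2 n) = 𝓕 (f - g) + 𝓕 (g - h) := by
    rw [← FourierTransform.fourier_add, sub_add_sub_cancel]
  rw [hadd]
  filter_upwards [Lp.coeFn_add (𝓕 (f - g) : L2 n) (𝓕 (g - h))] with η hη
  rw [hη, Pi.add_apply, Pi.add_apply, mul_add]

theorem sobolevNorm_le_mul_of_ae_le {l q B : ℝ} {f h : L2 n}
    (hfh : ∀ᵐ η, (1 + ‖freq η‖ ^ 2) ^ (l / 2) * ‖(𝓕 f : L2 n) η‖ ≤
      B * ((1 + ‖freq η‖ ^ 2) ^ (q / 2) * ‖(𝓕 h : L2 n) η‖)) :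
    sobolevNorm l f ≤ ENNReal.ofReal B * sobolevNorm q h := by
  refine eLpNorm_le_mul_eLpNorm_of_ae_le_mul ?_ 2
  filter_upwards [hfh] with η hη
  rwa [norm_mul, norm_mul, Complex.norm_real, Complex.norm_real,
    Real.norm_of_nonneg (by positivity), Real.norm_of_nonneg (by positivity)]

theorem coeFn_fourier_fourierMult {m : Rn n → ℝ} (hm : MemLp (fun η => m (freq η)) ∞ volume)
    (f : L2 n) :
    (𝓕 (fourierMult m f) : L2 n) =ᵐ[volume] fun η => (m (freq η) : ℂ) * (𝓕 f : L2 n) η := by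
  have hmul : MemLp (fun η => (m (freq η) : ℂ) * (𝓕 f : L2 n) η) 2 volume :=
    (Lp.memLp (mulOp hm (𝓕 f : L2 n))).ae_eq (coeFn_mulOp hm (𝓕 f : L2 n))
  rw [fourierMult, dif_pos hmul, FourierTransform.fourier_fourierInv_eq]
  exact hmul.coeFn_toLp

end SobolevNorm

section ConvergenceRate

/-! ### The convergence rate -/

variable {n : ℕ} {γ T τ s p α : ℝ}

theorem regSymbol_eq (γ T τ s α t : ℝ) (ξ : Rn n) :
    regSymbol γ T τ s α t ξ = mittagLeffler γ (-‖ξ‖ ^ 2 * t ^ γ) /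
      mittagLeffler γ (-‖ξ‖ ^ 2 * T ^ γ) * Real.exp (-τ * ‖α • ξ‖ ^ s) := by
  have hne : √(2 * π) ^ n ≠ 0 := by positivity
  rw [regSymbol, mollifierHat]
  field_simp

theorem regSymbol_zero (hγ : 0 < γ) (T τ s α : ℝ) (ξ : Rn n) :
    regSymbol γ T τ s α 0 ξ =
      Real.exp (-τ * ‖α • ξ‖ ^ s) / mittagLeffler γ (-‖ξ‖ ^ 2 * T ^ γ) := by
  rw [regSymbol_eq, Real.zero_rpow hγ.ne', mul_zero, mittagLeffler_zero, one_div_mul_eq_div]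

theorem regSymbol_nonneg (hγ : γ ∈ Ioo (0 : ℝ) 1) (hT : 0 ≤ T) (τ s α : ℝ) {t : ℝ}
    (ht : 0 ≤ t) (ξ : Rn n) : 0 ≤ regSymbol γ T τ s α t ξ := by
  rw [regSymbol_eq, neg_mul (‖ξ‖ ^ 2), neg_mul (‖ξ‖ ^ 2)]
  exact mul_nonneg (div_nonneg (mittagLeffler_neg_nonneg hγ (by positivity))
    (mittagLeffler_neg_nonneg hγ (by positivity))) (Real.exp_nonneg _)

theorem regSymbol_le_regSymbol_zero (hγ : γ ∈ Ioo (0 : ℝ) 1) (hT : 0 ≤ T) (τ s α : ℝ) {t : ℝ}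
    (ht : 0 ≤ t) (ξ : Rn n) : regSymbol γ T τ s α t ξ ≤ regSymbol γ T τ s α 0 ξ := by
  rw [regSymbol_zero hγ.1, regSymbol_eq, neg_mul (‖ξ‖ ^ 2), neg_mul (‖ξ‖ ^ 2), div_mul_eq_mul_div]
  have hnonneg := mittagLeffler_neg_nonneg hγ (x := ‖ξ‖ ^ 2 * T ^ γ) (by positivity)
  gcongr
  exact mul_le_of_le_one_left (Real.exp_nonneg _) (mittagLeffler_neg_le_one hγ (by positivity))

theorem regSymbol_zero_le (hγ : γ ∈ Ioo (0 : ℝ) 1) (hT : 0 ≤ T) (τ s α : ℝ) (ξ : Rn n) :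
    regSymbol γ T τ s α 0 ξ ≤
      (1 + Real.Gamma (1 - γ) * T ^ γ) * ((1 + ‖ξ‖ ^ 2) * Real.exp (-τ * ‖α • ξ‖ ^ s)) := by
  have hx : 0 ≤ ‖ξ‖ ^ 2 * T ^ γ := by positivity
  have hΓ : 0 ≤ Real.Gamma (1 - γ) * T ^ γ :=
    mul_nonneg (Real.Gamma_nonneg_of_nonneg (sub_nonneg.2 hγ.2.le)) (by positivity)
  have hE := mittagLeffler_neg_pos hγ hx
  have hle : 1 + Real.Gamma (1 - γ) * (‖ξ‖ ^ 2 * T ^ γ) ≤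
      (1 + Real.Gamma (1 - γ) * T ^ γ) * (1 + ‖ξ‖ ^ 2) := by nlinarith [sq_nonneg ‖ξ‖]
  rw [regSymbol_zero hγ.1, neg_mul (‖ξ‖ ^ 2), ← mul_assoc, div_le_iff₀ hE, mul_right_comm]
  exact le_mul_of_one_le_left (Real.exp_nonneg _)
    ((one_le_mul_mittagLeffler hγ hx).trans (by gcongr))

theorem exists_sobolevWeight_mul_regSymbol_le (hγ : γ ∈ Ioo (0 : ℝ) 1) (hT : 0 ≤ T) (hτ : 0 < τ)
    (hs : 0 < s) (hp : 0 ≤ p) (α₀ : ℝ) :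
    ∃ C : ℝ, 0 < C ∧ ∀ α ∈ Ioc 0 α₀, ∀ l ∈ Icc 0 p, ∀ ξ : Rn n,
      (1 + ‖ξ‖ ^ 2) ^ (l / 2) * regSymbol γ T τ s α 0 ξ ≤ C * α ^ (-(l + 2)) := by
  have hΓ := Real.Gamma_pos_of_pos (sub_pos.2 hγ.2)
  obtain ⟨C, hC, hbound⟩ :=
    exists_sobolevWeight_mul_exp_le (Q := p + 2) (by positivity) hτ hs α₀
  refine ⟨(1 + Real.Gamma (1 - γ) * T ^ γ) * C, by positivity, fun α hα l hl ξ => ?_⟩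
  have hweight : (1 + ‖ξ‖ ^ 2) ^ (l / 2) * (1 + ‖ξ‖ ^ 2) = (1 + ‖ξ‖ ^ 2) ^ ((l + 2) / 2) := by
    rw [add_div, div_self two_ne_zero, Real.rpow_add_one (by positivity)]
  have hl2 : l + 2 ∈ Icc 0 (p + 2) := ⟨by linarith [hl.1], by linarith [hl.2]⟩
  calc (1 + ‖ξ‖ ^ 2) ^ (l / 2) * regSymbol γ T τ s α 0 ξ
      ≤ (1 + ‖ξ‖ ^ 2) ^ (l / 2) * ((1 + Real.Gamma (1 - γ) * T ^ γ) *
          ((1 + ‖ξ‖ ^ 2) * Real.exp (-τ * ‖α • ξ‖ ^ s))) := by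
        gcongr
        exact regSymbol_zero_le hγ hT τ s α ξ
    _ = (1 + Real.Gamma (1 - γ) * T ^ γ) *
          ((1 + ‖ξ‖ ^ 2) ^ ((l + 2) / 2) * Real.exp (-τ * (α * ‖ξ‖) ^ s)) := by
        rw [← hweight, norm_smul, Real.norm_of_nonneg hα.1.le]
        ring
    _ ≤ (1 + Real.Gamma (1 - γ) * T ^ γ) * (C * α ^ (-(l + 2))) := by
        gcongr _ * ?_
        exact hbound α hα _ hl2 _ (norm_nonneg ξ)
    _ = (1 + Real.Gamma (1 - γ) * T ^ γ) * C * α ^ (-(l + 2)) := (mul_assoc _ _ _).symm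

theorem measurable_regSymbol (hγ : 0 < γ) (T τ s α t : ℝ) :
    Measurable fun η : Rn n => regSymbol γ T τ s α t (freq η) := by
  have hml (r : ℝ) : Measurable fun η : Rn n => mittagLeffler γ (-‖freq η‖ ^ 2 * r ^ γ) :=
    (continuous_mittagLeffler hγ).measurable.comp (by fun_prop)
  simp_rw [regSymbol_eq]
  exact ((hml t).div (hml T)).mul (by fun_prop)

theorem memLp_regSymbol (hγ : γ ∈ Ioo (0 : ℝ) 1) (hT : 0 ≤ T) (hτ : 0 < τ) (hs : 0 < s)
    (hα : 0 < α) {t : ℝ} (ht : 0 ≤ t) :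
    MemLp (fun η : Rn n => regSymbol γ T τ s α t (freq η)) ∞ volume := by
  obtain ⟨C, -, hbound⟩ :=
    exists_sobolevWeight_mul_regSymbol_le (n := n) hγ hT hτ hs le_rfl α
  refine memLp_top_of_bound (measurable_regSymbol hγ.1 T τ s α t).aestronglyMeasurable
    (C * α ^ (-(0 + 2) : ℝ)) (ae_of_all _ fun η => ?_)
  rw [Real.norm_of_nonneg (regSymbol_nonneg hγ hT τ s α ht _)]
  refine (regSymbol_le_regSymbol_zero hγ hT τ s α ht _).trans ?_
  simpa using hbound α ⟨hα, le_rfl⟩ 0 ⟨le_rfl, le_rfl⟩ (freq η)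

theorem coeFn_fourier_regSolution (hγ : γ ∈ Ioo (0 : ℝ) 1) (hT : 0 ≤ T) (hτ : 0 < τ) (hs : 0 < s)
    (hα : 0 < α) {t : ℝ} (ht : 0 ≤ t) (g : L2 n) :
    (𝓕 (regSolution γ T τ s α g t) : L2 n) =ᵐ[volume]
      fun η => (regSymbol γ T τ s α t (freq η) : ℂ) * (𝓕 g : L2 n) η :=
  coeFn_fourier_fourierMult (memLp_regSymbol hγ hT hτ hs hα ht) g

theorem IsSolution.fourier_regSolution_zero (hγ : γ ∈ Ioo (0 : ℝ) 1) (hT : 0 < T) (hτ : 0 < τ)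
    (hs : 0 < s) (hα : 0 < α) {g : L2 n} {u : ℝ → L2 n} (hu : IsSolution γ T g u) :
    (𝓕 (regSolution γ T τ s α g 0) : L2 n) =ᵐ[volume]
      fun η => (Real.exp (-τ * ‖α • freq η‖ ^ s) : ℂ) * (𝓕 (u 0) : L2 n) η := by
  have hfinal := hu.fourier_eq hγ hT (right_mem_Icc.2 hT.le)
  rw [hu.final] at hfinal
  filter_upwards [coeFn_fourier_regSolution hγ hT.le hτ hs hα le_rfl g, hfinal] with η hreg hη
  have hne := (mittagLeffler_neg_pos hγ (x := ‖freq η‖ ^ 2 * T ^ γ) (by positivity)).ne'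
  rw [← neg_mul (‖freq η‖ ^ 2)] at hne
  rw [hreg, hη, regSymbol_zero hγ.1, ← mul_assoc, ← Complex.ofReal_mul, div_mul_cancel₀ _ hne]

theorem IsSolution.sobolevNorm_sub_regSolution_le {l : ℝ} (hγ : γ ∈ Ioo (0 : ℝ) 1) (hT : 0 < T)
    (hτ : 0 < τ) (hs : 0 < s) (hlp : l ≤ p) (hls : p - l ≤ s) (hα : 0 < α) {g : L2 n}
    {u : ℝ → L2 n} (hu : IsSolution γ T g u) :
    sobolevNorm l (u 0 - regSolution γ T τ s α g 0) ≤
      ENNReal.ofReal (max 1 τ * α ^ (p - l)) * sobolevNorm p (u 0) := by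
  refine sobolevNorm_le_mul_of_ae_le ?_
  have hsub : (𝓕 (u 0 - regSolution γ T τ s α g 0) : L2 n) =
      𝓕 (u 0) - 𝓕 (regSolution γ T τ s α g 0) :=
    map_sub (FourierTransform.fourierCLM ℂ (L2 n)) _ _
  rw [hsub]
  filter_upwards [Lp.coeFn_sub (𝓕 (u 0) : L2 n) (𝓕 (regSolution γ T τ s α g 0)),
    hu.fourier_regSolution_zero hγ hT hτ hs hα] with η hη hreg
  have hexp : 0 ≤ 1 - Real.exp (-τ * ‖α • freq η‖ ^ s) := by
    rw [neg_mul, sub_nonneg, Real.exp_le_one_iff, neg_nonpos]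
    positivity
  rw [hη, Pi.sub_apply, hreg, ← one_sub_mul, ← Complex.ofReal_one, ← Complex.ofReal_sub,
    norm_mul, Complex.norm_real, Real.norm_of_nonneg hexp, ← mul_assoc, ← mul_assoc, norm_smul,
    Real.norm_of_nonneg hα.le]
  exact mul_le_mul_of_nonneg_right
    (sobolevWeight_mul_one_sub_exp_le hτ hs hlp hls hα.le (norm_nonneg _)) (norm_nonneg _)

theorem sobolevNorm_regSolution_sub_le {l B : ℝ} (hγ : γ ∈ Ioo (0 : ℝ) 1) (hT : 0 ≤ T)
    (hτ : 0 < τ) (hs : 0 < s) (hα : 0 < α)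
    (hB : ∀ ξ : Rn n, (1 + ‖ξ‖ ^ 2) ^ (l / 2) * regSymbol γ T τ s α 0 ξ ≤ B) (g h : L2 n) :
    sobolevNorm l (regSolution γ T τ s α g 0 - regSolution γ T τ s α h 0) ≤
      ENNReal.ofReal B * ‖g - h‖ₑ := by
  rw [← sobolevNorm_zero]
  refine sobolevNorm_le_mul_of_ae_le ?_
  have hsub (v w : L2 n) : (𝓕 (v - w) : L2 n) = 𝓕 v - 𝓕 w :=
    map_sub (FourierTransform.fourierCLM ℂ (L2 n)) v w
  rw [hsub, hsub]
  filter_upwards [coeFn_fourier_regSolution hγ hT hτ hs hα le_rfl g,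
    coeFn_fourier_regSolution hγ hT hτ hs hα le_rfl h, Lp.coeFn_sub (𝓕 g : L2 n) (𝓕 h),
    Lp.coeFn_sub (𝓕 (regSolution γ T τ s α g 0) : L2 n) (𝓕 (regSolution γ T τ s α h 0))]
    with η hg hh hdata hreg
  rw [hdata, hreg, Pi.sub_apply, Pi.sub_apply, hg, hh, ← mul_sub, norm_mul, Complex.norm_real,
    Real.norm_of_nonneg (regSymbol_nonneg hγ hT τ s α le_rfl _), ← mul_assoc, zero_div,
    Real.rpow_zero, one_mul]
  gcongr
  exact hB _

theorem rpow_parameter_choice {E δ : ℝ} (hE : 0 < E) (hδ : 0 < δ) (hp : p + 2 ≠ 0) :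
    ((δ / E) ^ (1 / (p + 2))) ^ (p + 2) = δ / E := by
  rw [← Real.rpow_mul (by positivity), one_div_mul_cancel hp, Real.rpow_one]

theorem rpow_parameter_choice_mul {E δ : ℝ} (hE : 0 < E) (hδ : 0 < δ) (hp : p + 2 ≠ 0) (l : ℝ) :
    ((δ / E) ^ (1 / (p + 2))) ^ (p - l) * E =
      E ^ ((2 + l) / (p + 2)) * δ ^ ((p - l) / (p + 2)) := by
  have hexp : (2 + l) / (p + 2) = 1 - (p - l) / (p + 2) := by
    field_simp
    ring
  rw [← Real.rpow_mul (by positivity), one_div_mul_eq_div, Real.div_rpow hδ.le hE.le, hexp,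
    Real.rpow_sub hE, Real.rpow_one]
  ring

theorem rpow_parameter_choice_neg_mul {E δ : ℝ} (hE : 0 < E) (hδ : 0 < δ) (hp : p + 2 ≠ 0)
    (l : ℝ) :
    ((δ / E) ^ (1 / (p + 2))) ^ (-(l + 2)) * δ =
      E ^ ((2 + l) / (p + 2)) * δ ^ ((p - l) / (p + 2)) := by
  rw [← rpow_parameter_choice_mul hE hδ hp, show p - l = -(l + 2) + (p + 2) by ring,
    Real.rpow_add (by positivity), rpow_parameter_choice hE hδ hp, mul_assoc,
    div_mul_cancel₀ _ hE.ne']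

theorem exists_convergence_rate (n : ℕ) {κ : ℝ} (hγ : γ ∈ Ioo (0 : ℝ) 1) (hT : 0 < T) (hτ : 0 < τ)
    (hs : 0 < s) (hp : 0 ≤ p) :
    ∃ C : ℝ, 0 < C ∧ ∀ E δ : ℝ, 0 < E → 0 < δ → δ ≤ κ * E →
      ∀ (u : ℝ → L2 n) (g gδ : L2 n), IsSolution γ T g u →
        sobolevNorm p (u 0) ≤ ENNReal.ofReal E → ‖g - gδ‖ ≤ δ →
        ∀ α : ℝ, α = (δ / E) ^ (1 / (p + 2)) → ∀ l ∈ Icc 0 p, p - l ≤ s →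
          sobolevNorm l (u 0 - regSolution γ T τ s α gδ 0) ≤
            ENNReal.ofReal (C * E ^ ((2 + l) / (p + 2)) * δ ^ ((p - l) / (p + 2))) := by
  obtain ⟨C, hC, hbound⟩ :=
    exists_sobolevWeight_mul_regSymbol_le (n := n) hγ hT.le hτ hs hp (κ ^ (1 / (p + 2)))
  refine ⟨max 1 τ + C, by positivity, ?_⟩
  rintro E δ hE hδ hδE u g gδ hu huE hgδ α hα l hl hls
  have hα_mem : α ∈ Ioc 0 (κ ^ (1 / (p + 2))) := by
    rw [hα]
    exact ⟨by positivity, by gcongr; exact (div_le_iff₀ hE).2 hδE⟩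
  have hα_pos := hα_mem.1
  have hgδ' : ‖g - gδ‖ₑ ≤ ENNReal.ofReal δ := by
    rw [← ofReal_norm]
    exact ENNReal.ofReal_le_ofReal hgδ
  calc sobolevNorm l (u 0 - regSolution γ T τ s α gδ 0)
      ≤ ENNReal.ofReal (max 1 τ * α ^ (p - l)) * sobolevNorm p (u 0) +
          ENNReal.ofReal (C * α ^ (-(l + 2))) * ‖g - gδ‖ₑ :=
        (sobolevNorm_sub_le l _ (regSolution γ T τ s α g 0) _).trans (add_le_add
          (hu.sobolevNorm_sub_regSolution_le hγ hT hτ hs hl.2 hls hα_pos)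
          (sobolevNorm_regSolution_sub_le hγ hT.le hτ hs hα_pos (hbound α hα_mem l hl) g gδ))
    _ ≤ ENNReal.ofReal (max 1 τ * α ^ (p - l)) * ENNReal.ofReal E +
          ENNReal.ofReal (C * α ^ (-(l + 2))) * ENNReal.ofReal δ := by gcongr
    _ = ENNReal.ofReal (max 1 τ * (α ^ (p - l) * E) + C * (α ^ (-(l + 2)) * δ)) := by
        rw [← ENNReal.ofReal_mul (by positivity), ← ENNReal.ofReal_mul (by positivity),
          ← ENNReal.ofReal_add (by positivity) (by positivity), mul_assoc, mul_assoc]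
    _ = ENNReal.ofReal ((max 1 τ + C) * E ^ ((2 + l) / (p + 2)) * δ ^ ((p - l) / (p + 2))) := by
        rw [hα, rpow_parameter_choice_mul hE hδ (by positivity),
          rpow_parameter_choice_neg_mul hE hδ (by positivity), ← add_mul, mul_assoc]

end ConvergenceRate

section LowerBound

/-! ### Order optimality -/

theorem exists_Lp_two_norm_eq {β : Type*} [MeasurableSpace β] {μ : Measure β} {S : Set β}
    (hS : MeasurableSet S) (hS₀ : μ S ≠ 0) (hS_top : μ S ≠ ∞) {b : ℝ} (hb : 0 ≤ b) :
    ∃ w : Lp ℂ 2 μ, ‖w‖ = b ∧ ∀ᵐ x ∂μ, x ∉ S → w x = 0 := by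
  have hpos : 0 < μ.real S := ENNReal.toReal_pos hS₀ hS_top
  refine ⟨indicatorConstLp 2 hS hS_top ((b / μ.real S ^ (1 / (2 : ℝ)) : ℝ) : ℂ), ?_,
    indicatorConstLp_coeFn_notMem⟩
  rw [norm_indicatorConstLp two_ne_zero ENNReal.ofNat_ne_top, Complex.norm_real,
    Real.norm_of_nonneg (by positivity), ENNReal.toReal_ofNat]
  exact div_mul_cancel₀ b (by positivity)

theorem norm_le_norm_sub_or_norm_le_norm_neg_sub {F : Type*} [NormedAddCommGroup F]
    [NormedSpace ℝ F] (w r : F) : ‖w‖ ≤ ‖w - r‖ ∨ ‖w‖ ≤ ‖-w - r‖ := by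
  have htwo : (2 : ℝ) • w = (w - r) - (-w - r) := by
    rw [two_smul]
    abel
  have hnorm := norm_sub_le (w - r) (-w - r)
  rw [← htwo, norm_smul, Real.norm_of_nonneg zero_le_two] at hnorm
  by_contra! h
  linarith [h.1, h.2]

variable {n : ℕ} {γ T p ρ : ℝ}

/-- The frequencies `ρ < |ξ| < 2ρ`. -/
def annulus (ρ : ℝ) : Set (Rn n) := {η | ‖freq η‖ ∈ Ioo ρ (2 * ρ)}

theorem norm_freq (η : Rn n) : ‖freq η‖ = 2 * π * ‖η‖ := by
  rw [freq, norm_smul, Real.norm_of_nonneg (by positivity)]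

theorem isOpen_annulus (ρ : ℝ) : IsOpen (annulus ρ : Set (Rn n)) := by
  have hfreq : Continuous (freq : Rn n → Rn n) := by
    unfold freq
    fun_prop
  exact isOpen_Ioo.preimage hfreq.norm

theorem annulus_nonempty (hn : 1 ≤ n) (hρ : 0 < ρ) : (annulus ρ : Set (Rn n)).Nonempty := by
  refine ⟨EuclideanSpace.single (⟨0, hn⟩ : Fin n) (3 / 2 * ρ / (2 * π)), ?_⟩
  have hnorm : ‖freq (EuclideanSpace.single (⟨0, hn⟩ : Fin n) (3 / 2 * ρ / (2 * π)))‖ =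
      3 / 2 * ρ := by
    rw [norm_freq, PiLp.norm_single, Real.norm_of_nonneg (by positivity),
      mul_div_cancel₀ _ (by positivity)]
  rw [annulus, mem_ofPred_eq, hnorm]
  constructor <;> linarith

theorem volume_annulus_ne_top (ρ : ℝ) : volume (annulus ρ : Set (Rn n)) ≠ ∞ := by
  have hsubset : (annulus ρ : Set (Rn n)) ⊆ Metric.ball 0 (2 * ρ) := by
    intro η hη
    have hlt := hη.2
    rw [norm_freq] at hlt
    rw [mem_ball_zero_iff]
    nlinarith [norm_nonneg η, Real.pi_gt_three]
  exact ((measure_mono hsubset).trans_lt measure_ball_lt_top).ne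

theorem exists_annulus_norm_eq (hn : 1 ≤ n) (hρ : 0 < ρ) {b : ℝ} (hb : 0 ≤ b) :
    ∃ w : L2 n, ‖w‖ = b ∧ ∀ᵐ η, η ∉ annulus ρ → w η = 0 :=
  exists_Lp_two_norm_eq (isOpen_annulus ρ).measurableSet
    ((isOpen_annulus ρ).measure_pos volume (annulus_nonempty hn hρ)).ne'
    (volume_annulus_ne_top ρ) hb

theorem mittagLeffler_neg_le_div (hγ : γ ∈ Ioo (0 : ℝ) 1) {x : ℝ} (hx : 0 < x) :
    mittagLeffler γ (-x) ≤ Real.Gamma (γ + 1) / x := by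
  have hΓ : 0 < Real.Gamma (γ + 1) := Real.Gamma_pos_of_pos (by linarith [hγ.1])
  have hE := mittagLeffler_neg_nonneg hγ hx.le
  have hle : x / Real.Gamma (γ + 1) * mittagLeffler γ (-x) ≤ 1 := by
    linarith [mul_mittagLeffler_le_one hγ hx.le]
  rwa [div_mul_eq_mul_div, div_le_one hΓ, mul_comm, ← le_div_iff₀ hx] at hle

theorem BandLimited.norm_mlSeries_le {N t : ℝ} {w : L2 n} (hw : BandLimited N w)
    (hγ : γ ∈ Ioo (0 : ℝ) 1) (hρ : 0 < ρ) (hhigh : ∀ᵐ η, ‖freq η‖ < ρ → w η = 0) (ht : 0 < t) :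
    ‖FracDiffusion.mlSeries γ 1 (truncLaplacian N) w t‖ ≤
      Real.Gamma (γ + 1) / (ρ ^ 2 * t ^ γ) * ‖w‖ := by
  have hΓ : 0 < Real.Gamma (γ + 1) := Real.Gamma_pos_of_pos (by linarith [hγ.1])
  refine Lp.norm_le_mul_norm_of_ae_le_mul ?_
  filter_upwards [hw.coeFn_mlSeries hγ.1 ht.le, hhigh] with η hη hzero
  rw [hη, norm_mul, Complex.norm_real, neg_mul (‖freq η‖ ^ 2),
    Real.norm_of_nonneg (mittagLeffler_neg_nonneg hγ (by positivity))]
  rcases lt_or_ge ‖freq η‖ ρ with hlt | hge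
  · simp [hzero hlt]
  have hfreq : 0 < ‖freq η‖ := hρ.trans_le hge
  gcongr
  exact (mittagLeffler_neg_le_div hγ (by positivity)).trans (by gcongr)

theorem norm_fourierInv_eq (w : L2 n) : ‖(𝓕⁻ w : L2 n)‖ = ‖w‖ :=
  (Lp.fourierTransformₗᵢ (Rn n) ℂ).symm.norm_map w

theorem exists_isSolution_of_annulus (hγ : γ ∈ Ioo (0 : ℝ) 1) (hT : 0 < T) (hp : 0 ≤ p)
    (hρ : 1 ≤ ρ) {w : L2 n} (hw : ∀ᵐ η, η ∉ annulus ρ → w η = 0) :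
    ∃ (u : ℝ → L2 n) (g : L2 n), IsSolution γ T g u ∧ u 0 = 𝓕⁻ w ∧
      sobolevNorm p (u 0) ≤ ENNReal.ofReal ((5 * ρ ^ 2) ^ (p / 2) * ‖w‖) ∧
      ‖g‖ ≤ Real.Gamma (γ + 1) / T ^ γ / ρ ^ 2 * ‖w‖ := by
  have hlow : BandLimited (2 * ρ) w := by
    filter_upwards [hw] with η hη hmem using hη fun h => hmem h.2.le
  have hhigh : ∀ᵐ η, ‖freq η‖ < ρ → w η = 0 := by
    filter_upwards [hw] with η hη hlt using hη fun h => hlt.not_gt h.1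
  have hu₀ : (𝓕⁻ (mlSeries γ 1 (truncLaplacian (2 * ρ)) w 0) : L2 n) = 𝓕⁻ w := by
    rw [mlSeries_zero hγ.1]
  refine ⟨_, _, hlow.isSolution hγ hT, hu₀, ?_, ?_⟩
  · rw [hu₀]
    refine (hlow.sobolevNorm_fourierInv_le hp).trans ?_
    rw [← ofReal_norm, ← ENNReal.ofReal_mul (by positivity)]
    gcongr
    nlinarith
  · rw [norm_fourierInv_eq, div_div, mul_comm (T ^ γ)]
    exact hlow.norm_mlSeries_le hγ (by linarith) hhigh hT

theorem exists_annulus_parameters {κ K : ℝ} (hp : 0 ≤ p) (hκ : 0 ≤ κ) (hK : 0 ≤ K) :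
    ∃ c : ℝ, 0 < c ∧ ∀ E δ : ℝ, 0 < E → 0 < δ → δ ≤ κ * E → ∃ ρ : ℝ, 1 ≤ ρ ∧
      (5 * ρ ^ 2) ^ (p / 2) * (c * E ^ (2 / (p + 2)) * δ ^ (p / (p + 2))) = E ∧
      K / ρ ^ 2 * (c * E ^ (2 / (p + 2)) * δ ^ (p / (p + 2))) ≤ δ := by
  have hp2 : p + 2 ≠ 0 := by positivity
  set a : ℝ := 1 + κ ^ (1 / (p + 2)) + K
  have hκ' : 0 ≤ κ ^ (1 / (p + 2)) := by positivity
  have ha_one : 1 ≤ a := by linarith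
  have ha_sq : K / a ^ 2 ≤ 1 := (div_le_one (by positivity)).2 (by nlinarith)
  set c : ℝ := ((5 : ℝ) ^ (p / 2) * a ^ p)⁻¹ with hc
  have hc_one : c ≤ 1 := inv_le_one_of_one_le₀ (one_le_mul_of_one_le_of_one_le
    (Real.one_le_rpow (by norm_num) (by positivity)) (Real.one_le_rpow ha_one hp))
  refine ⟨c, by positivity, fun E δ hE hδ hδE => ?_⟩
  set α : ℝ := (δ / E) ^ (1 / (p + 2)) with hα
  have hα_pos : 0 < α := by positivity
  have hα_le : α ≤ κ ^ (1 / (p + 2)) := by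
    rw [hα]
    gcongr
    exact (div_le_iff₀ hE).2 hδE
  have hrate : c * E ^ (2 / (p + 2)) * δ ^ (p / (p + 2)) = c * (α ^ p * E) := by
    have h := rpow_parameter_choice_mul hE hδ hp2 0
    rw [add_zero, sub_zero, ← hα] at h
    rw [h, mul_assoc]
  have hδ_eq : α ^ p * α ^ 2 * E = δ := by
    rw [← Real.rpow_two, ← Real.rpow_add hα_pos, hα, rpow_parameter_choice hE hδ hp2,
      div_mul_cancel₀ _ hE.ne']
  refine ⟨a / α, (one_le_div hα_pos).2 (by linarith), ?_, ?_⟩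
  · rw [hrate, Real.mul_rpow (by norm_num) (by positivity), sq_rpow_half (by positivity),
      Real.div_rpow (by positivity) hα_pos.le, hc]
    field_simp
  · calc K / (a / α) ^ 2 * (c * E ^ (2 / (p + 2)) * δ ^ (p / (p + 2)))
        = K / a ^ 2 * c * (α ^ p * α ^ 2 * E) := by
          rw [hrate]
          field_simp
      _ ≤ 1 * δ := by
          rw [hδ_eq]
          gcongr
          exact mul_le_one₀ ha_sq (by positivity) hc_one
      _ = δ := one_mul δ

theorem exists_lower_bound (hn : 1 ≤ n) {κ : ℝ} (hγ : γ ∈ Ioo (0 : ℝ) 1) (hT : 0 < T)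
    (hp : 0 ≤ p) (hκ : 0 ≤ κ) :
    ∃ c : ℝ, 0 < c ∧ ∀ E δ : ℝ, 0 < E → 0 < δ → δ ≤ κ * E → ∀ R : L2 n → L2 n,
      ∃ (u : ℝ → L2 n) (g gδ : L2 n), IsSolution γ T g u ∧
        sobolevNorm p (u 0) ≤ ENNReal.ofReal E ∧ ‖g - gδ‖ ≤ δ ∧
        c * E ^ (2 / (p + 2)) * δ ^ (p / (p + 2)) ≤ ‖u 0 - R gδ‖ := by
  have hΓ : 0 < Real.Gamma (γ + 1) := Real.Gamma_pos_of_pos (by linarith [hγ.1])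
  obtain ⟨c, hc, hparam⟩ :=
    exists_annulus_parameters (K := Real.Gamma (γ + 1) / T ^ γ) hp hκ (by positivity)
  refine ⟨c, hc, fun E δ hE hδ hδE R => ?_⟩
  obtain ⟨ρ, hρ, hsob, hdata⟩ := hparam E δ hE hδ hδE
  set b : ℝ := c * E ^ (2 / (p + 2)) * δ ^ (p / (p + 2))
  have hsol (v : L2 n) (hv : ∀ᵐ η, η ∉ annulus ρ → v η = 0) (hvb : ‖v‖ = b)
      (hR : b ≤ ‖(𝓕⁻ v : L2 n) - R 0‖) :
      ∃ (u : ℝ → L2 n) (g gδ : L2 n), IsSolution γ T g u ∧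
        sobolevNorm p (u 0) ≤ ENNReal.ofReal E ∧ ‖g - gδ‖ ≤ δ ∧ b ≤ ‖u 0 - R gδ‖ := by
    obtain ⟨u, g, hu, hu₀, hup, hg⟩ := exists_isSolution_of_annulus hγ hT hp hρ hv
    rw [hvb] at hup hg
    exact ⟨u, g, 0, hu, hsob ▸ hup, by rw [sub_zero]; exact hg.trans hdata, by rwa [hu₀]⟩
  obtain ⟨w, hwb, hw⟩ :=
    exists_annulus_norm_eq hn (zero_lt_one.trans_le hρ) (b := b) (by positivity)
  have hw_neg : ∀ᵐ η, η ∉ annulus ρ → (-w) η = 0 := by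
    filter_upwards [hw, Lp.coeFn_neg w] with η hη hneg hmem
    rw [hneg, Pi.neg_apply, hη hmem, neg_zero]
  have hF_neg : (𝓕⁻ (-w) : L2 n) = -(𝓕⁻ w : L2 n) :=
    map_neg (FourierTransform.fourierInvCLM ℂ (L2 n)) w
  have hF_norm : ‖(𝓕⁻ w : L2 n)‖ = b := (norm_fourierInv_eq w).trans hwb
  rcases norm_le_norm_sub_or_norm_le_norm_neg_sub (𝓕⁻ w : L2 n) (R 0) with h | h
  · exact hsol w hw hwb (hF_norm ▸ h)
  · exact hsol (-w) hw_neg ((norm_neg w).trans hwb) (by rwa [hF_neg, ← hF_norm])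

end LowerBound

end FracDiffusion

end

open FracDiffusion in
theorem mainTheorem1 (n : ℕ) (hn : 1 ≤ n) (γ T τ s p κ : ℝ)
    (hγ : γ ∈ Set.Ioo (0 : ℝ) 1) (hT : 0 < T) (hτ : 0 < τ) (hs : 0 < s) (hp : 0 < p)
    (hκ : 0 < κ) :
    -- the convergence rate of the regularized solution
    (∃ C : ℝ, 0 < C ∧ ∀ E δ : ℝ, 0 < E → 0 < δ → δ ≤ κ * E →
      ∀ (u : ℝ → L2 n) (g gδ : L2 n), IsSolution γ T g u →
        sobolevNorm p (u 0) ≤ ENNReal.ofReal E → ‖g - gδ‖ ≤ δ →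
        ∀ α : ℝ, α = (δ / E) ^ (1 / (p + 2)) →
          -- `u_α^δ(·,t)` is well defined by its Fourier transform
          (∀ t ∈ Set.Icc 0 T, (𝓕 (regSolution γ T τ s α gδ t) : L2 n) =ᵐ[volume]
            fun η => (regSymbol γ T τ s α t (freq η) : ℂ) * (𝓕 gδ : L2 n) η) ∧
          ∀ l ∈ Set.Icc 0 p, p - l ≤ s →
            sobolevNorm l (u 0 - regSolution γ T τ s α gδ 0) ≤
              ENNReal.ofReal (C * E ^ ((2 + l) / (p + 2)) * δ ^ ((p - l) / (p + 2)))) ∧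
    -- for `l = 0` the rate is order-optimal: no reconstruction map has a better worst-case rate
    (∃ c : ℝ, 0 < c ∧ ∀ E δ : ℝ, 0 < E → 0 < δ → δ ≤ κ * E → ∀ R : L2 n → L2 n,
      ∃ (u : ℝ → L2 n) (g gδ : L2 n), IsSolution γ T g u ∧
        sobolevNorm p (u 0) ≤ ENNReal.ofReal E ∧ ‖g - gδ‖ ≤ δ ∧
        c * E ^ (2 / (p + 2)) * δ ^ (p / (p + 2)) ≤ ‖u 0 - R gδ‖) := by
  refine ⟨?_, exists_lower_bound hn hγ hT hp.le hκ.le⟩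
  obtain ⟨C, hC, hrate⟩ := exists_convergence_rate n (κ := κ) hγ hT hτ hs hp.le
  refine ⟨C, hC, fun E δ hE hδ hδE u g gδ hu huE hgδ α hα =>
    ⟨fun t ht => ?_, hrate E δ hE hδ hδE u g gδ hu huE hgδ α hα⟩⟩
  have hα_pos : 0 < α := by
    rw [hα]
    positivity
  exact coeFn_fourier_regSolution hγ hT.le hτ hs hα_pos ht.1 gδ
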